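/- Let $\gamma>1$, $\mu>0$, $\overline S\in\mathbb R$, and let $A=(\gamma e^{\overline S})^{-1}$ (so that the sound speed of the constant state $\rho=1$, $S=\overline S$ is $1$). Consider the compressible ideal MHD system in $\mathbb R^3$ $$\rho_t+\nabla\cdot(\rho u)=0,\qquad \rho(\partial_t u+u\cdot\nabla u)+\nabla p-\mu^{-1}(\nabla\times B)\times B=0,$$ $$S_t+u\cdot\nabla S=0,\qquad B_t-\nabla\times(u\times B)=0,\qquad \nabla\cdot B=0,\qquad p=A\rho^\gamma e^S .$$ Let $\rho_0,S_0:\mathbb R^3\to\mathbb R$ and $u_0,B_0:\mathbb R^3\to\mathbb R^3$ be $C^1$ functions (in particular, they may be smooth) supported in $\{|x|\le 1\}$, with $S_0\ge 0$, and suppose that $$\int_{\mathbb R^3}\rho_0F\,dx+\int_{\mathbb R^3}\nabla F\cdot u_0\,dx>0,\qquad F(x)=\int_{S^2}e^{\omega\cdot x}\,d\omega .$$ Then there are constants $C>0$ and $\varepsilon_0>0$, independent of $\varepsilon$ and of the solution, such that for every $0<\varepsilon\le\varepsilon_0$ the following holds. If $(\rho,u,S,B)$ is a $C^1$ solution of the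 system on $[0,T)\times\mathbb R^3$, $0<T\le\infty$, with $\rho>0$ and initial data $$\rho|_{t=0}=1+\varepsilon\rho_0,\qquad u|_{t=0}=\varepsilon u_0,\qquad S|_{t=0}=\overline S+\varepsilon S_0,\qquad B|_{t=0}=\varepsilon B_0,$$ which is axisymmetric, that is, in cylindrical coordinates $(r,\theta,z)$, $$u=u^r(t,r,z)e^r+u^z(t,r,z)e^z,\qquad B=B^\theta(t,r,z)e^\theta,\qquad \rho=\rho(t,r,z),\qquad S=S(t,r,z),$$ then $T\le\exp(C\varepsilon^{-1})$. In particular no such solution is global: the $C^1$ solution breaks down in finite time, and its lifespan is at most $\exp(C\varepsilon^{-1})$. -/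

import Mathlib

open MeasureTheory Set
open scoped Gradient

noncomputable section

namespace MHD

/-- Euclidean three-space. -/
abbrev E3 : Type := EuclideanSpace ℝ (Fin 3)

/-- The partial derivative of a scalar function in the `i`-th coordinate direction. -/
def pd (i : Fin 3) (f : E3 → ℝ) (x : E3) : ℝ :=
  fderiv ℝ f x (EuclideanSpace.single i 1)

/-- The divergence of a vector field. -/
def divg (v : E3 → E3) (x : E3) : ℝ :=
  ∑ i : Fin 3, pd i (fun y => v y i) x

/-- The curl of a vector field. -/
def curl (v : E3 → E3) (x : E3) : E3 :=
  !₂[pd 1 (fun y => v y 2) x - pd 2 (fun y => v y 1) x,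
     pd 2 (fun y => v y 0) x - pd 0 (fun y => v y 2) x,
     pd 0 (fun y => v y 1) x - pd 1 (fun y => v y 0) x]

/-- The cross product of two vectors. -/
def cross (a b : E3) : E3 :=
  !₂[a 1 * b 2 - a 2 * b 1, a 2 * b 0 - a 0 * b 2, a 0 * b 1 - a 1 * b 0]

/-- The polytropic equation of state `p = A ρ ^ γ e ^ S`. -/
def pressure (A γ ρ S : ℝ) : ℝ := A * ρ ^ γ * Real.exp S

/-- `[0, T) × ℝ³` as a subset of space-time; `T = ⊤` means all nonnegative times. -/
def slab (T : EReal) : Set (ℝ × E3) := {q | 0 ≤ q.1 ∧ (q.1 : EReal) < T}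

/-- `(ρ, u, S, B)` is a `C¹` solution on `[0, T) × ℝ³`, with positive density, of the compressible
ideal MHD equations. The time derivatives are two-sided because the equations are
written for `0 < t`; they pass to `t = 0` by continuity of the first derivatives on the slab. -/
structure IsC1Solution (A γ μ : ℝ) (T : EReal)
    (ρ : ℝ → E3 → ℝ) (u : ℝ → E3 → E3) (S : ℝ → E3 → ℝ) (B : ℝ → E3 → E3) : Prop where
  contDiff_density : ContDiffOn ℝ 1 (fun q : ℝ × E3 => ρ q.1 q.2) (slab T)
  contDiff_velocity : ContDiffOn ℝ 1 (fun q : ℝ × E3 => u q.1 q.2) (slab T)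
  contDiff_entropy : ContDiffOn ℝ 1 (fun q : ℝ × E3 => S q.1 q.2) (slab T)
  contDiff_magnetic : ContDiffOn ℝ 1 (fun q : ℝ × E3 => B q.1 q.2) (slab T)
  density_pos : ∀ (t : ℝ) (x : E3), 0 ≤ t → (t : EReal) < T → 0 < ρ t x
  mass : ∀ (t : ℝ) (x : E3), 0 < t → (t : EReal) < T →
    deriv (fun s => ρ s x) t + divg (fun y => ρ t y • u t y) x = 0
  momentum : ∀ (t : ℝ) (x : E3), 0 < t → (t : EReal) < T →
    ρ t x • (deriv (fun s => u s x) t + fderiv ℝ (u t) x (u t x))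
      + ∇ (fun y => pressure A γ (ρ t y) (S t y)) x
      - μ⁻¹ • cross (curl (B t) x) (B t x) = 0
  entropy : ∀ (t : ℝ) (x : E3), 0 < t → (t : EReal) < T →
    deriv (fun s => S s x) t + inner ℝ (u t x) (∇ (S t) x) = 0
  induction : ∀ (t : ℝ) (x : E3), 0 < t → (t : EReal) < T →
    deriv (fun s => B s x) t - curl (fun y => cross (u t y) (B t y)) x = 0
  divergence_free : ∀ (t : ℝ) (x : E3), 0 ≤ t → (t : EReal) < T → divg (B t) x = 0

/-- The distance from `x` to the `x₃`-axis. -/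
def cylR (x : E3) : ℝ := Real.sqrt (x 0 ^ 2 + x 1 ^ 2)

/-- The radial unit vector of cylindrical coordinates (meaningful off the axis). -/
def eR (x : E3) : E3 := !₂[x 0 / cylR x, x 1 / cylR x, 0]

/-- The angular unit vector of cylindrical coordinates (meaningful off the axis). -/
def eTheta (x : E3) : E3 := !₂[-(x 1) / cylR x, x 0 / cylR x, 0]

/-- The vertical unit vector. -/
def eZ : E3 := !₂[0, 0, 1]

/-- Axisymmetric without swirl: `u = uʳ eʳ + uᶻ eᶻ`, `B = Bᶿ eᶿ`, and `ρ`, `S` (hence also the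
pressure) are functions of `(t, r, z)`. Only asked off the axis, where the frame is defined. -/
def IsAxisymmetric (T : EReal)
    (ρ : ℝ → E3 → ℝ) (u : ℝ → E3 → E3) (S : ℝ → E3 → ℝ) (B : ℝ → E3 → E3) : Prop :=
  ∃ ρc ur uz Sc Bθ : ℝ → ℝ → ℝ → ℝ,
    ∀ (t : ℝ) (x : E3), 0 ≤ t → (t : EReal) < T → cylR x ≠ 0 →
      ρ t x = ρc t (cylR x) (x 2) ∧
      u t x = ur t (cylR x) (x 2) • eR x + uz t (cylR x) (x 2) • eZ ∧
      S t x = Sc t (cylR x) (x 2) ∧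
      B t x = Bθ t (cylR x) (x 2) • eTheta x

/-- The test function `F(x) = ∫_{S²} exp(ω · x) dω`, with the surface measure on the sphere. -/
def F (x : E3) : ℝ :=
  ∫ ω : Metric.sphere (0 : E3) 1, Real.exp (inner ℝ (ω : E3) x) ∂((volume : Measure E3).toSphere)

end MHD

end

noncomputable section

namespace MHD

open Filter Topology Asymptotics

/-! The argument is a moment method in the style of Sideris. Put X = ∫ (ρ - 1) F and Y = ∫ ρ u · ∇F.
The mass equation gives X' = Y. The momentum equation in divergence form gives Y' as the integral of
the total stress contracted with the Hessian of F.

Three facts turn this into Y' ≥ ∫ (p - p̄) F, with p̄ = 1/γ. The Hessian of F is nonnegative, so the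
kinetic stress helps. The trace of the Hessian is F. In a direction orthogonal to x the Hessian is
at most half its trace (`hessian_F_le`), and an azimuthal B is orthogonal to x
(`inner_eq_zero_of_axisymmetric`), so magnetic pressure beats magnetic tension
(`pressure_le_stress`).

Two facts about the solution make the pressure integral useful. An energy estimate on backward cones
keeps the perturbation inside |x| ≤ 1 + t (`eq_const_of_one_add_lt_norm`); the cones have slope one
because the background is unmagnetised with sound speed one. The entropy never drops below its
background value (`le_entropy`), so p ≥ p̄ ρ ^ γ. Jensen's inequality on the ball of radius 1 + t
(`le_integral_pressure`), with the F-mass of that ball at most K (1 + t) e^t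
(`setIntegral_ball_F_le`), then bounds Y' below by a convex function of X.

With Z = e^{-t} X and M = e^{-t} (X + Y) this reads Z' = M - 2 Z, M' ≥ 0, and M' ≥ K (1 + t) ·
`excess` γ (Z / (K (1 + t))) where Z ≥ 0. The positivity assumption makes M at least of order ε, so
Z becomes of order ε after a time independent of ε. The excess is quadratic on bounded ranges, so Z
dominates a solution of z' = c z² / (1 + t); as 1/z falls only logarithmically, z gets large by a
time exp(C/ε). Beyond that the excess grows like the power γ and blow-up takes at most one more unit
of time. Both stages use one comparison principle (`MomentSystem.subsolution_le`) and are joined in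
`MomentSystem.lifespan`. -/

/-- The directional derivative of a scalar function on space-time. -/
def dir (v : ℝ × E3) (f : ℝ × E3 → ℝ) (q : ℝ × E3) : ℝ := fderiv ℝ f q v

/-- The unit vector of space-time in the time direction. -/
def tvec : ℝ × E3 := (1, 0)

/-- The unit vector of space-time in the `i`-th space direction. -/
def xvec (i : Fin 3) : ℝ × E3 := (0, EuclideanSpace.single i 1)

/-! ### Calculus on the slab, up to the initial time -/

lemma slab_mem_nhds {T : EReal} {q : ℝ × E3} (h0 : 0 < q.1) (hT : (q.1 : EReal) < T) :
    slab T ∈ 𝓝 q := by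
  have h1 : {q : ℝ × E3 | 0 < q.1} ∈ 𝓝 q :=
    (isOpen_lt continuous_const continuous_fst).mem_nhds h0
  have h2 : {q : ℝ × E3 | (q.1 : EReal) < T} ∈ 𝓝 q :=
    (isOpen_lt (continuous_coe_real_ereal.comp continuous_fst) continuous_const).mem_nhds hT
  filter_upwards [h1, h2] with p hp1 hp2 using ⟨hp1.le, hp2⟩

lemma convex_slab (T : EReal) : Convex ℝ (slab T) := by
  intro p hp q hq a b ha hb hab
  have hp1 := hp.1
  have hq1 := hq.1
  refine ⟨?_, ?_⟩
  · simp only [Prod.fst_add, Prod.smul_fst, smul_eq_mul]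
    positivity
  · have hm : (a • p + b • q).1 ≤ max p.1 q.1 := by
      simp only [Prod.fst_add, Prod.smul_fst, smul_eq_mul]
      nlinarith [le_max_left p.1 q.1, le_max_right p.1 q.1]
    refine lt_of_le_of_lt (EReal.coe_le_coe_iff.2 hm) ?_
    rcases max_choice p.1 q.1 with h | h <;> rw [h]
    exacts [hp.2, hq.2]

/-- A convex set with interior has unique derivatives; for T ≤ 0 the slab is empty. This is what
makes `fderivWithin` continuous up to t = 0. -/
lemma uniqueDiffOn_slab (T : EReal) : UniqueDiffOn ℝ (slab T) := by
  by_cases hT : 0 < T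
  · obtain ⟨t, ht0, htT⟩ := EReal.lt_iff_exists_real_btwn.1 hT
    refine uniqueDiffOn_convex (convex_slab T) ⟨(t, 0), ?_⟩
    exact mem_interior_iff_mem_nhds.2 (slab_mem_nhds (EReal.coe_pos.1 ht0) htT)
  · have : slab T = ∅ := by
      ext q
      simp only [mem_empty_iff_false, iff_false]
      rintro ⟨h0, h1⟩
      exact hT (lt_of_le_of_lt (EReal.coe_nonneg.2 h0) h1)
    rw [this]
    exact uniqueDiffOn_empty

lemma differentiableAt_of_slab {E : Type*} [NormedAddCommGroup E] [NormedSpace ℝ E]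
    {T : EReal} {f : ℝ × E3 → E} (hf : ContDiffOn ℝ 1 f (slab T))
    {q : ℝ × E3} (h0 : 0 < q.1) (hT : (q.1 : EReal) < T) : DifferentiableAt ℝ f q :=
  (hf.differentiableOn (by norm_num)).differentiableAt (slab_mem_nhds h0 hT)

lemma continuousAt_fderiv_of_slab {T : EReal} {f : ℝ × E3 → ℝ} (hf : ContDiffOn ℝ 1 f (slab T))
    {q : ℝ × E3} (h0 : 0 < q.1) (hT : (q.1 : EReal) < T) : ContinuousAt (fderiv ℝ f) q :=
  (hf.contDiffAt (slab_mem_nhds h0 hT)).continuousAt_fderiv (by norm_num)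

lemma mem_slab_of_le {T : EReal} {t₁ : ℝ} (ht₁ : (t₁ : EReal) < T) {q : ℝ × E3}
    (h0 : 0 ≤ q.1) (h1 : q.1 ≤ t₁) : q ∈ slab T :=
  ⟨h0, lt_of_le_of_lt (EReal.coe_le_coe_iff.2 h1) ht₁⟩

lemma isCompact_cylinder (t₁ R : ℝ) (x₀ : E3) :
    IsCompact (Icc 0 t₁ ×ˢ Metric.closedBall x₀ R : Set (ℝ × E3)) :=
  isCompact_Icc.prod (isCompact_closedBall x₀ R)

lemma exists_bound_of_slab {T : EReal} {f : ℝ × E3 → ℝ} (hf : ContinuousOn f (slab T))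
    {t₁ : ℝ} (ht₁ : (t₁ : EReal) < T) (R : ℝ) (x₀ : E3) :
    ∃ C : ℝ, ∀ q : ℝ × E3, 0 ≤ q.1 → q.1 ≤ t₁ → q.2 ∈ Metric.closedBall x₀ R → ‖f q‖ ≤ C := by
  obtain ⟨C, hC⟩ := (isCompact_cylinder t₁ R x₀).exists_bound_of_continuousOn
    (hf.mono (fun q hq => mem_slab_of_le ht₁ hq.1.1 hq.1.2))
  exact ⟨C, fun q h0 h1 h2 => hC q ⟨⟨h0, h1⟩, h2⟩⟩

/-- The derivative within the slab is continuous on a compact cylinder that includes t = 0, and it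
agrees with the full derivative for t > 0. Hence the bound does not degenerate as t tends to 0. -/
lemma exists_bound_dir_of_slab {T : EReal} {f : ℝ × E3 → ℝ} (hf : ContDiffOn ℝ 1 f (slab T))
    (v : ℝ × E3) {t₁ : ℝ} (ht₁ : (t₁ : EReal) < T) (R : ℝ) (x₀ : E3) :
    ∃ C : ℝ, ∀ q : ℝ × E3, 0 < q.1 → q.1 ≤ t₁ → q.2 ∈ Metric.closedBall x₀ R →
      ‖dir v f q‖ ≤ C := by
  have hc : ContinuousOn (fun q => fderivWithin ℝ f (slab T) q v) (slab T) :=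
    (hf.continuousOn_fderivWithin (uniqueDiffOn_slab T) (by norm_num)).clm_apply
      continuousOn_const
  obtain ⟨C, hC⟩ := (isCompact_cylinder t₁ R x₀).exists_bound_of_continuousOn
    (hc.mono (fun q hq => mem_slab_of_le ht₁ hq.1.1 hq.1.2))
  refine ⟨C, fun q h0 h1 h2 => ?_⟩
  have := hC q ⟨⟨h0.le, h1⟩, h2⟩
  rwa [fderivWithin_of_mem_nhds (slab_mem_nhds h0
    (lt_of_le_of_lt (EReal.coe_le_coe_iff.2 h1) ht₁))] at this

lemma hasDerivAt_time {E : Type*} [NormedAddCommGroup E] [NormedSpace ℝ E]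
    {f : ℝ × E3 → E} {q : ℝ × E3} (hf : DifferentiableAt ℝ f q) :
    HasDerivAt (fun s => f (s, q.2)) (fderiv ℝ f q tvec) q.1 := by
  have h : HasDerivAt (fun s : ℝ => ((s, q.2) : ℝ × E3)) tvec q.1 :=
    (hasDerivAt_id q.1).prodMk (hasDerivAt_const q.1 q.2)
  exact HasFDerivAt.comp_hasDerivAt (x := q.1) (f := fun s : ℝ => ((s, q.2) : ℝ × E3))
    hf.hasFDerivAt h

lemma hasFDerivAt_space {E : Type*} [NormedAddCommGroup E] [NormedSpace ℝ E]
    {f : ℝ × E3 → E} {q : ℝ × E3} (hf : DifferentiableAt ℝ f q) :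
    HasFDerivAt (fun y => f (q.1, y))
      ((fderiv ℝ f q).comp (ContinuousLinearMap.inr ℝ ℝ E3)) q.2 := by
  have h : HasFDerivAt (fun y : E3 => ((q.1, y) : ℝ × E3))
      (ContinuousLinearMap.inr ℝ ℝ E3) q.2 := hasFDerivAt_prodMk_right q.1 q.2
  exact HasFDerivAt.comp (f := fun y : E3 => ((q.1, y) : ℝ × E3)) q.2 hf.hasFDerivAt h

lemma pd_slice {f : ℝ × E3 → ℝ} {q : ℝ × E3} (hf : DifferentiableAt ℝ f q) (i : Fin 3) :
    pd i (fun y => f (q.1, y)) q.2 = dir (xvec i) f q := by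
  rw [pd, (hasFDerivAt_space hf).fderiv]
  rfl

/-! ### Integrals over time slices and balance laws -/

/-- The integral of a directional derivative of a compactly supported `C¹` function vanishes. -/
lemma integral_fderiv_eq_zero {g : E3 → ℝ} (hg : ContDiff ℝ 1 g) (hs : HasCompactSupport g)
    (v : E3) : ∫ x, fderiv ℝ g x v = 0 := by
  have hc : Continuous (fun x => fderiv ℝ g x v) :=
    (hg.continuous_fderiv (by norm_num)).clm_apply continuous_const
  have hcs : HasCompactSupport (fun x => fderiv ℝ g x v) := hs.fderiv_apply (𝕜 := ℝ) v
  have h := integral_mul_fderiv_eq_neg_fderiv_mul_of_integrable (μ := (volume : Measure E3))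
    (f := fun _ => (1 : ℝ)) (g := g) (v := v) (by simp)
    (by simpa using hc.integrable_of_hasCompactSupport hcs)
    (by simpa using hg.continuous.integrable_of_hasCompactSupport hs)
    (fun x _ => differentiableAt_const _)
    (fun x _ => hg.differentiable (by norm_num) x)
  simpa using h

lemma hasCompactSupport_of_norm {g : E3 → ℝ} {R : ℝ} (h : ∀ x, R < ‖x‖ → g x = 0) :
    HasCompactSupport g := by
  refine HasCompactSupport.intro (isCompact_closedBall (0 : E3) R) fun x hx => h x ?_
  simpa using hx

lemma continuous_slice {T : EReal} {f : ℝ × E3 → ℝ} (hf : ContinuousOn f (slab T)) {t : ℝ}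
    (h0 : 0 ≤ t) (hT : (t : EReal) < T) : Continuous (fun x => f (t, x)) :=
  hf.comp_continuous (by fun_prop) (fun _ => ⟨h0, hT⟩)

lemma integrable_slice {T : EReal} {f : ℝ × E3 → ℝ} (hf : ContinuousOn f (slab T)) {t : ℝ}
    (h0 : 0 ≤ t) (hT : (t : EReal) < T) {R : ℝ} (hs : ∀ x, R < ‖x‖ → f (t, x) = 0) :
    Integrable (fun x => f (t, x)) :=
  (continuous_slice hf h0 hT).integrable_of_hasCompactSupport (hasCompactSupport_of_norm hs)

lemma contDiff_slice {T : EReal} {f : ℝ × E3 → ℝ} (hf : ContDiffOn ℝ 1 f (slab T)) {t : ℝ}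
    (h0 : 0 ≤ t) (hT : (t : EReal) < T) : ContDiff ℝ 1 (fun x => f (t, x)) := by
  rw [← contDiffOn_univ]
  exact hf.comp (f := fun x : E3 => ((t, x) : ℝ × E3)) (by fun_prop) (fun _ _ => ⟨h0, hT⟩)

/-- Continuity must include t = 0, because every monotonicity argument below starts from the initial
data while the equations hold only for t > 0. -/
lemma continuousOn_integral_slice {T : EReal} {a : ℝ × E3 → ℝ} (ha : ContinuousOn a (slab T))
    (hsupp : ∀ t₁ : ℝ, (t₁ : EReal) < T → ∃ R : ℝ, ∀ q : ℝ × E3, 0 ≤ q.1 → q.1 ≤ t₁ →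
      R < ‖q.2‖ → a q = 0) :
    ContinuousOn (fun t => ∫ x, a (t, x)) {t : ℝ | 0 ≤ t ∧ (t : EReal) < T} := by
  rintro t ⟨h0, hT⟩
  obtain ⟨t₁, ht1, ht1T⟩ := EReal.lt_iff_exists_real_btwn.1 hT
  replace ht1 : t < t₁ := EReal.coe_lt_coe_iff.1 ht1
  obtain ⟨R, hR⟩ := hsupp t₁ ht1T
  obtain ⟨C, hC⟩ := exists_bound_of_slab ha ht1T R 0
  have hev : ∀ᶠ s in 𝓝[{t : ℝ | 0 ≤ t ∧ (t : EReal) < T}] t, 0 ≤ s ∧ s ≤ t₁ := by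
    filter_upwards [self_mem_nhdsWithin, mem_nhdsWithin_of_mem_nhds (Iio_mem_nhds ht1)] with s h1 h2
    exact ⟨h1.1, le_of_lt h2⟩
  refine continuousWithinAt_of_dominated
    (bound := (Metric.closedBall (0 : E3) R).indicator fun _ => C) ?_ ?_ ?_ ?_
  · filter_upwards [hev] with s hs
    exact (continuous_slice ha hs.1 (mem_slab_of_le (q := (s, 0)) ht1T hs.1 hs.2).2
      ).aestronglyMeasurable
  · filter_upwards [hev] with s hs
    refine Eventually.of_forall fun x => ?_
    by_cases hx : x ∈ Metric.closedBall (0 : E3) R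
    · rw [indicator_of_mem hx]
      exact hC (s, x) hs.1 hs.2 hx
    · rw [indicator_of_notMem hx, hR (s, x) hs.1 hs.2 (by simpa using hx)]
      simp
  · exact (integrable_indicator_iff Metric.isClosed_closedBall.measurableSet).2
      (integrableOn_const (isCompact_closedBall _ _).measure_lt_top.ne)
  · refine Eventually.of_forall fun x => ?_
    have h := ha (t, x) ⟨h0, hT⟩
    refine ContinuousWithinAt.comp (g := a) (f := fun s : ℝ => ((s, x) : ℝ × E3)) h
      (by fun_prop) (fun s hs => hs)

lemma hasDerivAt_integral_slice {T : EReal} {a : ℝ × E3 → ℝ} (ha : ContDiffOn ℝ 1 a (slab T))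
    (hsupp : ∀ t₁ : ℝ, (t₁ : EReal) < T → ∃ R : ℝ, ∀ q : ℝ × E3, 0 ≤ q.1 → q.1 ≤ t₁ →
      R < ‖q.2‖ → a q = 0) {t : ℝ} (h0 : 0 < t) (hT : (t : EReal) < T) :
    Integrable (fun x => dir tvec a (t, x)) ∧
    HasDerivAt (fun t => ∫ x, a (t, x)) (∫ x, dir tvec a (t, x)) t := by
  obtain ⟨t₁, ht1, ht1T⟩ := EReal.lt_iff_exists_real_btwn.1 hT
  replace ht1 : t < t₁ := EReal.coe_lt_coe_iff.1 ht1
  obtain ⟨R, hR⟩ := hsupp t₁ ht1T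
  obtain ⟨C, hC⟩ := exists_bound_dir_of_slab ha tvec ht1T R 0
  have hlt : ∀ s ∈ Ioo 0 t₁, (s : EReal) < T := fun s hs =>
    (EReal.coe_lt_coe_iff.2 hs.2).trans ht1T
  refine hasDerivAt_integral_of_dominated_loc_of_deriv_le
    (bound := (Metric.closedBall (0 : E3) R).indicator fun _ => C)
    (F' := fun s x => dir tvec a (s, x)) (Ioo_mem_nhds h0 ht1) ?_ ?_ ?_ ?_ ?_ ?_
  · filter_upwards [Ioo_mem_nhds h0 ht1] with s hs
    exact (continuous_slice ha.continuousOn hs.1.le (hlt s hs)).aestronglyMeasurable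
  · exact integrable_slice ha.continuousOn h0.le hT (fun x hx => hR (t, x) h0.le ht1.le hx)
  · refine Continuous.aestronglyMeasurable (continuous_iff_continuousAt.2 fun x => ?_)
    have h := continuousAt_fderiv_of_slab ha (q := (t, x)) h0 hT
    exact (ContinuousAt.comp (f := fun x : E3 => ((t, x) : ℝ × E3)) (x := x) h
      (by fun_prop)).clm_apply continuousAt_const
  · refine Eventually.of_forall fun x s hs => ?_
    by_cases hx : x ∈ Metric.closedBall (0 : E3) R
    · rw [indicator_of_mem hx]
      exact hC (s, x) hs.1 hs.2.le hx
    · rw [indicator_of_notMem hx]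
      have hx' : R < ‖x‖ := by simpa using hx
      have hd := hasDerivAt_time (differentiableAt_of_slab ha (q := (s, x)) hs.1 (hlt s hs))
      -- Outside the ball the function vanishes at all nearby times, not only at time s, so its time
      -- derivative vanishes too.
      have hz : HasDerivAt (fun s => a (s, x)) 0 s := by
        refine (hasDerivAt_const s (0 : ℝ)).congr_of_eventuallyEq ?_
        filter_upwards [Ioo_mem_nhds hs.1 hs.2] with r hr
        exact hR (r, x) hr.1.le hr.2.le hx'
      rw [dir, hd.unique hz]
      simp
  · exact (integrable_indicator_iff Metric.isClosed_closedBall.measurableSet).2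
      (integrableOn_const (isCompact_closedBall _ _).measure_lt_top.ne)
  · exact Eventually.of_forall fun x s hs =>
      hasDerivAt_time (differentiableAt_of_slab ha (q := (s, x)) hs.1 (hlt s hs))

/-- The rate of change of the integral of a density that satisfies a balance law. -/
theorem hasDerivAt_integral_balance {T : EReal} {a : ℝ × E3 → ℝ} {b : Fin 3 → ℝ × E3 → ℝ}
    (ha : ContDiffOn ℝ 1 a (slab T)) (hb : ∀ j, ContDiffOn ℝ 1 (b j) (slab T))
    (hsupp : ∀ t₁ : ℝ, (t₁ : EReal) < T → ∃ R : ℝ, ∀ q : ℝ × E3, 0 ≤ q.1 → q.1 ≤ t₁ →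
      R < ‖q.2‖ → a q = 0 ∧ ∀ j, b j q = 0) {t : ℝ} (h0 : 0 < t) (hT : (t : EReal) < T) :
    Integrable (fun x => dir tvec a (t, x) + ∑ j, dir (xvec j) (b j) (t, x)) ∧
    HasDerivAt (fun t => ∫ x, a (t, x))
      (∫ x, (dir tvec a (t, x) + ∑ j, dir (xvec j) (b j) (t, x))) t := by
  obtain ⟨hi, hd⟩ := hasDerivAt_integral_slice ha (fun t₁ h => by
    obtain ⟨R, hR⟩ := hsupp t₁ h
    exact ⟨R, fun q h0 h1 h2 => (hR q h0 h1 h2).1⟩) h0 hT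
  obtain ⟨R, hR⟩ := hsupp t hT
  have hslice : ∀ j, ∀ x, dir (xvec j) (b j) (t, x) =
      fderiv ℝ (fun x => b j (t, x)) x (EuclideanSpace.single j 1) := fun j x =>
    (pd_slice (differentiableAt_of_slab (hb j) (q := (t, x)) h0 hT) j).symm
  have hcd := fun j => contDiff_slice (hb j) h0.le hT
  have hcs : ∀ j, HasCompactSupport (fun x => b j (t, x)) := fun j =>
    hasCompactSupport_of_norm (fun x hx => (hR (t, x) h0.le le_rfl hx).2 j)
  have hint : ∀ j, Integrable (fun x => dir (xvec j) (b j) (t, x)) := fun j => by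
    simp_rw [hslice]
    exact (((hcd j).continuous_fderiv (by norm_num)).clm_apply
      continuous_const).integrable_of_hasCompactSupport ((hcs j).fderiv_apply (𝕜 := ℝ) _)
  have hz : ∀ j, ∫ x, dir (xvec j) (b j) (t, x) = 0 := fun j => by
    simp_rw [hslice]
    exact integral_fderiv_eq_zero (hcd j) (hcs j) _
  refine ⟨hi.add (integrable_finsetSum _ fun j _ => hint j), ?_⟩
  rw [integral_add hi (integrable_finsetSum _ fun j _ => hint j),
    integral_finsetSum _ fun j _ => hint j]
  simpa [hz] using hd

/-! ### Rules for directional derivatives and components -/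

section DirRules

variable {v : ℝ × E3} {f g : ℝ × E3 → ℝ} {q : ℝ × E3}

lemma dir_add (hf : DifferentiableAt ℝ f q) (hg : DifferentiableAt ℝ g q) :
    dir v (fun q => f q + g q) q = dir v f q + dir v g q := by
  simp [dir, fderiv_fun_add hf hg]

lemma dir_sub (hf : DifferentiableAt ℝ f q) (hg : DifferentiableAt ℝ g q) :
    dir v (fun q => f q - g q) q = dir v f q - dir v g q := by
  simp [dir, fderiv_fun_sub hf hg]

lemma dir_sub_const (c : ℝ) : dir v (fun q => f q - c) q = dir v f q := by
  rw [dir, fderiv_sub_const, dir]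

lemma dir_mul (hf : DifferentiableAt ℝ f q) (hg : DifferentiableAt ℝ g q) :
    dir v (fun q => f q * g q) q = dir v f q * g q + f q * dir v g q := by
  simp [dir, fderiv_fun_mul hf hg]
  ring

lemma dir_const_mul (c : ℝ) (hf : DifferentiableAt ℝ f q) :
    dir v (fun q => c * f q) q = c * dir v f q := by
  simp [dir, fderiv_const_mul hf c]

lemma dir_sum {ι : Type*} (s : Finset ι) {f : ι → ℝ × E3 → ℝ}
    (hf : ∀ i ∈ s, DifferentiableAt ℝ (f i) q) :
    dir v (fun q => ∑ i ∈ s, f i q) q = ∑ i ∈ s, dir v (f i) q := by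
  simp [dir, fderiv_fun_sum hf]

lemma dir_comp {φ : ℝ → ℝ} {φ' : ℝ} (hφ : HasDerivAt φ φ' (f q)) (hf : DifferentiableAt ℝ f q) :
    dir v (fun q => φ (f q)) q = φ' * dir v f q := by
  have h := hφ.comp_hasFDerivAt q hf.hasFDerivAt
  rw [dir, show (fun q => φ (f q)) = φ ∘ f from rfl, h.fderiv]
  simp [dir]

lemma dir_sq (hf : DifferentiableAt ℝ f q) :
    dir v (fun q => f q ^ 2) q = 2 * (f q * dir v f q) := by
  simp_rw [pow_two]
  rw [dir_mul hf hf]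
  ring

end DirRules

lemma dir_tvec_space {g : E3 → ℝ} {q : ℝ × E3} (hg : DifferentiableAt ℝ g q.2) :
    dir tvec (fun q => g q.2) q = 0 := by
  have h := hg.hasFDerivAt.comp q (hasFDerivAt_snd (𝕜 := ℝ) (p := q))
  rw [dir, show (fun q : ℝ × E3 => g q.2) = g ∘ Prod.snd from rfl, h.fderiv]
  simp [tvec]

lemma dir_xvec_space {g : E3 → ℝ} {q : ℝ × E3} (hg : DifferentiableAt ℝ g q.2) (i : Fin 3) :
    dir (xvec i) (fun q => g q.2) q = pd i g q.2 := by
  have h := hg.hasFDerivAt.comp q (hasFDerivAt_snd (𝕜 := ℝ) (p := q))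
  rw [dir, show (fun q : ℝ × E3 => g q.2) = g ∘ Prod.snd from rfl, h.fderiv]
  simp [xvec, pd]

lemma gradient_apply (f : E3 → ℝ) (x : E3) (i : Fin 3) : (∇ f x) i = pd i f x := by
  have h : inner ℝ (∇ f x) (EuclideanSpace.single i (1 : ℝ)) = pd i f x := by
    rw [gradient, InnerProductSpace.toDual_symm_apply, pd]
  rw [← h, EuclideanSpace.inner_single_right]
  simp

lemma inner_eq_sum (x y : E3) : inner ℝ x y = ∑ i, x i * y i := by
  rw [PiLp.inner_apply]
  exact Finset.sum_congr rfl fun i _ => by simp [mul_comm]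

lemma sum_smul_xvec (w : E3) : ((0, w) : ℝ × E3) = ∑ j, w j • xvec j := by
  refine Prod.ext (by simp [xvec, Prod.fst_sum]) ?_
  simp only [xvec, Prod.snd_sum, Prod.smul_snd]
  ext i
  fin_cases i <;> simp [Fin.sum_univ_three]

lemma dir_component {U : ℝ × E3 → E3} {q : ℝ × E3} (hU : DifferentiableAt ℝ U q)
    (v : ℝ × E3) (i : Fin 3) : dir v (fun q => U q i) q = (fderiv ℝ U q v) i := by
  have h := ((PiLp.proj 2 (𝕜 := ℝ) (fun _ : Fin 3 => ℝ) i).hasFDerivAt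
    (x := U q)).comp q hU.hasFDerivAt
  have h' : HasFDerivAt (fun q => U q i) _ q := h
  rw [dir, h'.fderiv]
  rfl

/-! ### The system in scalar form -/

/-- The equations of compressible ideal MHD in scalar form, for the density `r`, the components
`w` of the velocity, the pressure `p`, the entropy `s` and the components `b` of the
magnetic field, with all products differentiated out. -/
structure ScalarSolution (γ μ : ℝ) (T : EReal) (r : ℝ × E3 → ℝ) (w : Fin 3 → ℝ × E3 → ℝ)
    (p s : ℝ × E3 → ℝ) (b : Fin 3 → ℝ × E3 → ℝ) : Prop where
  contDiff_r : ContDiffOn ℝ 1 r (slab T)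
  contDiff_w : ∀ i, ContDiffOn ℝ 1 (w i) (slab T)
  contDiff_p : ContDiffOn ℝ 1 p (slab T)
  contDiff_s : ContDiffOn ℝ 1 s (slab T)
  contDiff_b : ∀ i, ContDiffOn ℝ 1 (b i) (slab T)
  pos : ∀ q ∈ slab T, 0 < r q
  mass : ∀ q ∈ slab T, 0 < q.1 →
    dir tvec r q = -∑ j, (dir (xvec j) r q * w j q + r q * dir (xvec j) (w j) q)
  momentum : ∀ q ∈ slab T, 0 < q.1 → ∀ i,
    r q * dir tvec (w i) q = -(r q * ∑ j, w j q * dir (xvec j) (w i) q) - dir (xvec i) p q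
      + μ⁻¹ * ∑ j, b j q * (dir (xvec j) (b i) q - dir (xvec i) (b j) q)
  entropy : ∀ q ∈ slab T, 0 < q.1 → dir tvec s q = -∑ j, w j q * dir (xvec j) s q
  pressure : ∀ q ∈ slab T, 0 < q.1 →
    dir tvec p q = -∑ j, (w j q * dir (xvec j) p q + γ * p q * dir (xvec j) (w j) q)
  induction : ∀ q ∈ slab T, 0 < q.1 → ∀ i,
    dir tvec (b i) q = ∑ j, (w i q * dir (xvec j) (b j) q + b j q * dir (xvec j) (w i) q
      - w j q * dir (xvec j) (b i) q - b i q * dir (xvec j) (w j) q)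
  divergence_free : ∀ q ∈ slab T, 0 < q.1 → ∑ j, dir (xvec j) (b j) q = 0

section Components

variable {A γ μ : ℝ} {T : EReal} {ρ : ℝ → E3 → ℝ} {u : ℝ → E3 → E3} {S : ℝ → E3 → ℝ}
  {B : ℝ → E3 → E3}

lemma contDiffOn_component {U : ℝ × E3 → E3} {s : Set (ℝ × E3)} (hU : ContDiffOn ℝ 1 U s)
    (i : Fin 3) : ContDiffOn ℝ 1 (fun q => U q i) s :=
  (PiLp.proj 2 (𝕜 := ℝ) (fun _ : Fin 3 => ℝ) i).contDiff.comp_contDiffOn hU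

lemma contDiffOn_pressure {r s : ℝ × E3 → ℝ} {D : Set (ℝ × E3)} (hr : ContDiffOn ℝ 1 r D)
    (hs : ContDiffOn ℝ 1 s D) (hpos : ∀ q ∈ D, 0 < r q) :
    ContDiffOn ℝ 1 (fun q => pressure A γ (r q) (s q)) D := by
  unfold pressure
  exact (contDiffOn_const.mul (hr.rpow_const_of_ne fun q hq => (hpos q hq).ne')).mul hs.exp

/-- Multiplying by the density replaces r ^ (γ - 1) by r ^ γ, so the right side involves the
pressure itself and the chain rule becomes linear in it. -/
lemma dir_pressure {r s : ℝ × E3 → ℝ} {q v : ℝ × E3} (hr : DifferentiableAt ℝ r q)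
    (hs : DifferentiableAt ℝ s q) (hpos : 0 < r q) :
    r q * dir v (fun q => pressure A γ (r q) (s q)) q =
      γ * pressure A γ (r q) (s q) * dir v r q
        + r q * pressure A γ (r q) (s q) * dir v s q := by
  have h1 : dir v (fun q => r q ^ γ) q = γ * r q ^ (γ - 1) * dir v r q :=
    dir_comp (φ := fun x => x ^ γ) (Real.hasDerivAt_rpow_const (Or.inl hpos.ne')) hr
  have h2 : dir v (fun q => Real.exp (s q)) q = Real.exp (s q) * dir v s q :=
    dir_comp (φ := Real.exp) (Real.hasDerivAt_exp _) hs
  have d1 : DifferentiableAt ℝ (fun q => r q ^ γ) q := hr.rpow_const (Or.inl hpos.ne')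
  have d2 : DifferentiableAt ℝ (fun q => Real.exp (s q)) q := hs.exp
  have h3 : r q * r q ^ (γ - 1) = r q ^ γ := by
    rw [Real.rpow_sub_one hpos.ne']
    field_simp
  unfold pressure
  rw [dir_mul (d1.const_mul A) d2, dir_const_mul A d1, h1, h2, ← h3]
  ring

/-- The pressure equation is not among the given ones: it follows from mass and entropy transport
through the equation of state. The term with div B in the induction equation is left in place, as
the curl identity produces it. -/
theorem IsC1Solution.scalarSolution (h : IsC1Solution A γ μ T ρ u S B) :
    ScalarSolution γ μ T (fun q => ρ q.1 q.2) (fun i q => u q.1 q.2 i)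
      (fun q => pressure A γ (ρ q.1 q.2) (S q.1 q.2)) (fun q => S q.1 q.2)
      (fun i q => B q.1 q.2 i) := by
  have cw := fun i => contDiffOn_component h.contDiff_velocity i
  have cb := fun i => contDiffOn_component h.contDiff_magnetic i
  have hpos : ∀ q ∈ slab T, 0 < ρ q.1 q.2 := fun q hq => h.density_pos _ _ hq.1 hq.2
  have cp := contDiffOn_pressure (A := A) (γ := γ) h.contDiff_density h.contDiff_entropy hpos
  have hmass : ∀ q ∈ slab T, 0 < q.1 → dir tvec (fun q => ρ q.1 q.2) q =
      -∑ j, (dir (xvec j) (fun q => ρ q.1 q.2) q * u q.1 q.2 j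
        + ρ q.1 q.2 * dir (xvec j) (fun q => u q.1 q.2 j) q) := by
    intro q hq h0
    have dr := differentiableAt_of_slab h.contDiff_density h0 hq.2
    have dw := fun i => differentiableAt_of_slab (cw i) h0 hq.2
    have e := h.mass q.1 q.2 h0 hq.2
    have e1 : deriv (fun s => ρ s q.2) q.1 = dir tvec (fun q => ρ q.1 q.2) q :=
      (hasDerivAt_time dr).deriv
    have e2 : divg (fun y => ρ q.1 y • u q.1 y) q.2 =
        ∑ j, (dir (xvec j) (fun q => ρ q.1 q.2) q * u q.1 q.2 j
          + ρ q.1 q.2 * dir (xvec j) (fun q => u q.1 q.2 j) q) := by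
      refine Finset.sum_congr rfl fun j _ => ?_
      rw [← dir_mul dr (dw j), ← pd_slice (dr.fun_mul (dw j))]
      rfl
    rw [e1, e2] at e
    linarith
  have hent : ∀ q ∈ slab T, 0 < q.1 → dir tvec (fun q => S q.1 q.2) q =
      -∑ j, u q.1 q.2 j * dir (xvec j) (fun q => S q.1 q.2) q := by
    intro q hq h0
    have ds := differentiableAt_of_slab h.contDiff_entropy h0 hq.2
    have e := h.entropy q.1 q.2 h0 hq.2
    have e1 : deriv (fun s => S s q.2) q.1 = dir tvec (fun q => S q.1 q.2) q :=
      (hasDerivAt_time ds).deriv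
    have e2 : inner ℝ (u q.1 q.2) (∇ (S q.1) q.2) =
        ∑ j, u q.1 q.2 j * dir (xvec j) (fun q => S q.1 q.2) q := by
      rw [inner_eq_sum]
      refine Finset.sum_congr rfl fun j _ => ?_
      rw [gradient_apply, ← pd_slice ds]
    rw [e1, e2] at e
    linarith
  refine ⟨h.contDiff_density, cw, cp, h.contDiff_entropy, cb, hpos, hmass, ?_, hent, ?_, ?_, ?_⟩
  · intro q hq h0 i
    have dU := differentiableAt_of_slab h.contDiff_velocity h0 hq.2
    have dB := fun i => differentiableAt_of_slab (cb i) h0 hq.2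
    have dp := differentiableAt_of_slab cp h0 hq.2
    have e := congrArg (fun v : E3 => v i) (h.momentum q.1 q.2 h0 hq.2)
    have e1 : (deriv (fun s => u s q.2) q.1) i = dir tvec (fun q => u q.1 q.2 i) q := by
      rw [dir_component (U := fun q => u q.1 q.2) dU, ← (hasDerivAt_time dU).deriv]
    have e2 : (fderiv ℝ (u q.1) q.2 (u q.1 q.2)) i =
        ∑ j, u q.1 q.2 j * dir (xvec j) (fun q => u q.1 q.2 i) q := by
      have := (hasFDerivAt_space dU).fderiv
      rw [show u q.1 = fun y => u q.1 y from rfl, this, ContinuousLinearMap.comp_apply,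
        ContinuousLinearMap.inr_apply, sum_smul_xvec, map_sum]
      simp [Fin.sum_univ_three, dir_component (U := fun q => u q.1 q.2) dU]
    have e3 := gradient_apply (fun y => pressure A γ (ρ q.1 y) (S q.1 y)) q.2 i
    have e4 := pd_slice dp i
    have e5 : ∀ i j, pd i (fun y => B q.1 y j) q.2 = dir (xvec i) (fun q => B q.1 q.2 j) q :=
      fun i j => pd_slice (dB j) i
    have e6 : (cross (curl (B q.1) q.2) (B q.1 q.2)) i = ∑ j, B q.1 q.2 j *
        (dir (xvec j) (fun q => B q.1 q.2 i) q - dir (xvec i) (fun q => B q.1 q.2 j) q) := by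
      simp only [← e5]
      fin_cases i <;> simp [cross, curl, Fin.sum_univ_three] <;> ring
    simp only [PiLp.add_apply, PiLp.sub_apply, PiLp.smul_apply, PiLp.zero_apply, smul_eq_mul,
      e1, e2, e3, e4, e6] at e
    linarith
  · intro q hq h0
    have dr := differentiableAt_of_slab h.contDiff_density h0 hq.2
    have ds := differentiableAt_of_slab h.contDiff_entropy h0 hq.2
    have hr := hpos q hq
    have e := fun v => dir_pressure (A := A) (γ := γ) (v := v) dr ds hr
    refine mul_left_cancel₀ hr.ne' ?_
    have h1 := hmass q hq h0
    have h2 := hent q hq h0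
    have e0 := e tvec
    have e1 := e (xvec 0)
    have e2 := e (xvec 1)
    have e3 := e (xvec 2)
    rw [h1, h2] at e0
    rw [e0]
    simp only [Fin.sum_univ_three]
    linear_combination u q.1 q.2 0 * e1 + u q.1 q.2 1 * e2 + u q.1 q.2 2 * e3
  · intro q hq h0 i
    have dU := fun i => differentiableAt_of_slab (cw i) h0 hq.2
    have dV := differentiableAt_of_slab h.contDiff_magnetic h0 hq.2
    have dB := fun i => differentiableAt_of_slab (cb i) h0 hq.2
    have e := congrArg (fun v : E3 => v i) (h.induction q.1 q.2 h0 hq.2)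
    have e1 : (deriv (fun s => B s q.2) q.1) i = dir tvec (fun q => B q.1 q.2 i) q := by
      rw [dir_component (U := fun q => B q.1 q.2) dV, ← (hasDerivAt_time dV).deriv]
    have e2 : ∀ i j k, pd i (fun y => u q.1 y j * B q.1 y k - u q.1 y k * B q.1 y j) q.2 =
        dir (xvec i) (fun q => u q.1 q.2 j) q * B q.1 q.2 k
        + u q.1 q.2 j * dir (xvec i) (fun q => B q.1 q.2 k) q
        - (dir (xvec i) (fun q => u q.1 q.2 k) q * B q.1 q.2 j
        + u q.1 q.2 k * dir (xvec i) (fun q => B q.1 q.2 j) q) := fun i j k => by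
      rw [← dir_mul (dU j) (dB k), ← dir_mul (dU k) (dB j),
        ← dir_sub ((dU j).fun_mul (dB k)) ((dU k).fun_mul (dB j)),
        ← pd_slice (((dU j).fun_mul (dB k)).fun_sub ((dU k).fun_mul (dB j)))]
    simp only [PiLp.sub_apply, PiLp.zero_apply, e1] at e
    rw [sub_eq_zero] at e
    rw [e]
    fin_cases i <;> simp [cross, curl, Fin.sum_univ_three, e2] <;> ring
  · intro q hq h0
    have dB := fun i => differentiableAt_of_slab (cb i) h0 hq.2
    rw [← h.divergence_free q.1 q.2 hq.1 hq.2]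
    exact Finset.sum_congr rfl fun j _ => (pd_slice (dB j) j).symm

end Components

/-! ### Energy of the perturbation -/

/-- Grönwall's inequality for a function that starts at a nonpositive value. -/
lemma nonpos_of_deriv_le_mul {f f' : ℝ → ℝ} {C a b : ℝ} (hab : a ≤ b)
    (hc : ContinuousOn f (Icc a b)) (hd : ∀ t ∈ Ioo a b, HasDerivAt f (f' t) t)
    (hle : ∀ t ∈ Ioo a b, f' t ≤ C * f t) (ha : f a ≤ 0) : f b ≤ 0 := by
  have hdg : ∀ t ∈ Ioo a b, HasDerivAt (fun t => Real.exp (-C * t) * f t)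
      (Real.exp (-C * t) * (-C * 1) * f t + Real.exp (-C * t) * f' t) t := fun t ht =>
    (((hasDerivAt_id t).const_mul (-C)).exp).mul (hd t ht)
  have hanti : AntitoneOn (fun t => Real.exp (-C * t) * f t) (Icc a b) := by
    refine antitoneOn_of_deriv_nonpos (convex_Icc a b)
      ((Continuous.continuousOn (by fun_prop)).mul hc) ?_ ?_
    · rw [interior_Icc]
      exact fun t ht => (hdg t ht).differentiableAt.differentiableWithinAt
    · rw [interior_Icc]
      intro t ht
      rw [(hdg t ht).deriv]
      have := mul_le_mul_of_nonneg_left (hle t ht) (Real.exp_pos (-C * t)).le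
      linarith
  have h := hanti (left_mem_Icc.2 hab) (right_mem_Icc.2 hab) hab
  simp only at h
  have h1 : Real.exp (-C * a) * f a ≤ 0 :=
    mul_nonpos_of_nonneg_of_nonpos (Real.exp_pos _).le ha
  exact nonpos_of_mul_nonpos_right (h.trans h1) (Real.exp_pos _)

section Energy

variable {γ μ : ℝ} {T : EReal} {r p s : ℝ × E3 → ℝ} {w b : Fin 3 → ℝ × E3 → ℝ} {pb : ℝ}

/-- The energy density of the perturbation of the constant state. -/
def energy (pb : ℝ) (r : ℝ × E3 → ℝ) (w : Fin 3 → ℝ × E3 → ℝ) (p : ℝ × E3 → ℝ)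
    (b : Fin 3 → ℝ × E3 → ℝ) (q : ℝ × E3) : ℝ :=
  2⁻¹ * ((p q - pb) ^ 2 + ∑ i, w i q ^ 2 + ∑ i, b i q ^ 2 + (r q - p q - (1 - pb)) ^ 2)

lemma energy_nonneg (q : ℝ × E3) : 0 ≤ energy pb r w p b q := by
  unfold energy
  positivity

lemma eq_of_energy_eq_zero {q : ℝ × E3} (h : energy pb r w p b q = 0) :
    p q = pb ∧ (∀ i, w i q = 0) ∧ (∀ i, b i q = 0) ∧ r q = 1 := by
  unfold energy at h
  have h1 : 0 ≤ ∑ i, w i q ^ 2 := Finset.sum_nonneg fun i _ => sq_nonneg _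
  have h2 : 0 ≤ ∑ i, b i q ^ 2 := Finset.sum_nonneg fun i _ => sq_nonneg _
  have hp : p q - pb = 0 := by
    refine pow_eq_zero_iff (two_ne_zero) |>.1 ?_
    nlinarith [sq_nonneg (p q - pb), sq_nonneg (r q - p q - (1 - pb))]
  have hr : r q - p q - (1 - pb) = 0 := by
    refine pow_eq_zero_iff (two_ne_zero) |>.1 ?_
    nlinarith [sq_nonneg (p q - pb), sq_nonneg (r q - p q - (1 - pb))]
  have hw : ∑ i, w i q ^ 2 = 0 := by
    nlinarith [sq_nonneg (p q - pb), sq_nonneg (r q - p q - (1 - pb))]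
  have hb : ∑ i, b i q ^ 2 = 0 := by
    nlinarith [sq_nonneg (p q - pb), sq_nonneg (r q - p q - (1 - pb))]
  rw [Finset.sum_eq_zero_iff_of_nonneg fun i _ => sq_nonneg _] at hw hb
  exact ⟨by linarith, fun i => pow_eq_zero_iff (two_ne_zero) |>.1 (hw i (Finset.mem_univ i)),
    fun i => pow_eq_zero_iff (two_ne_zero) |>.1 (hb i (Finset.mem_univ i)), by linarith⟩

lemma contDiffOn_energy (h : ScalarSolution γ μ T r w p s b) :
    ContDiffOn ℝ 1 (energy pb r w p b) (slab T) := by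
  unfold energy
  have h1 : ContDiffOn ℝ 1 (fun q => ∑ i, w i q ^ 2) (slab T) :=
    ContDiffOn.sum fun i _ => (h.contDiff_w i).pow 2
  have h2 : ContDiffOn ℝ 1 (fun q => ∑ i, b i q ^ 2) (slab T) :=
    ContDiffOn.sum fun i _ => (h.contDiff_b i).pow 2
  exact contDiffOn_const.mul (((((h.contDiff_p.sub contDiffOn_const).pow 2).add h1).add h2).add
    (((h.contDiff_r.sub h.contDiff_p).sub contDiffOn_const).pow 2))

lemma dir_energy {q v : ℝ × E3} (dr : DifferentiableAt ℝ r q) (dw : ∀ i, DifferentiableAt ℝ (w i) q)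
    (dp : DifferentiableAt ℝ p q) (db : ∀ i, DifferentiableAt ℝ (b i) q) :
    dir v (energy pb r w p b) q = (p q - pb) * dir v p q + ∑ i, w i q * dir v (w i) q
      + ∑ i, b i q * dir v (b i) q + (r q - p q - (1 - pb)) * (dir v r q - dir v p q) := by
  have d1 := dp.sub_const pb
  have d2 := (dr.fun_sub dp).sub_const (1 - pb)
  have d3 : DifferentiableAt ℝ (fun q => ∑ i, w i q ^ 2) q :=
    DifferentiableAt.fun_sum fun i _ => (dw i).fun_pow 2
  have d4 : DifferentiableAt ℝ (fun q => ∑ i, b i q ^ 2) q :=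
    DifferentiableAt.fun_sum fun i _ => (db i).fun_pow 2
  unfold energy
  rw [dir_const_mul _ ((((d1.fun_pow 2).fun_add d3).fun_add d4).fun_add (d2.fun_pow 2)),
    dir_add (((d1.fun_pow 2).fun_add d3).fun_add d4) (d2.fun_pow 2),
    dir_add ((d1.fun_pow 2).fun_add d3) d4, dir_add (d1.fun_pow 2) d3,
    dir_sum _ fun i _ => (dw i).fun_pow 2, dir_sum _ fun i _ => (db i).fun_pow 2,
    dir_sq d1, dir_sq d2, dir_sub_const, dir_sub_const, dir_sub dr dp]
  simp_rw [fun i => dir_sq (v := v) (dw i), fun i => dir_sq (v := v) (db i)]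
  simp only [← Finset.mul_sum]
  ring

/-- The part of the energy balance that is quadratic in the perturbation. -/
lemma energy_balance (h : ScalarSolution γ μ T r w p s b) (hpb : γ * pb = 1) {q : ℝ × E3}
    (hq : q ∈ slab T) (h0 : 0 < q.1) :
    dir tvec (energy pb r w p b) q + ∑ j, dir (xvec j) (fun q => (p q - pb) * w j q) q =
      (p q - pb) * (-∑ j, (w j q * dir (xvec j) p q
        + (p q - pb) * (γ * dir (xvec j) (w j) q)))
      + ∑ i, w i q * (((r q - p q - (1 - pb)) + (p q - pb)) * ((r q)⁻¹ * dir (xvec i) p q)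
        - ∑ j, w j q * dir (xvec j) (w i) q
        + ∑ j, b j q * (μ⁻¹ * (r q)⁻¹ * (dir (xvec j) (b i) q - dir (xvec i) (b j) q)))
      + ∑ i, b i q * ∑ j, (w i q * dir (xvec j) (b j) q + b j q * dir (xvec j) (w i) q
        - w j q * dir (xvec j) (b i) q - b i q * dir (xvec j) (w j) q)
      + (r q - p q - (1 - pb)) * ∑ j, (w j q * (dir (xvec j) p q - dir (xvec j) r q)
        + (γ * (p q - pb) - ((r q - p q - (1 - pb)) + (p q - pb))) * dir (xvec j) (w j) q) := by
  have dr := differentiableAt_of_slab h.contDiff_r h0 hq.2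
  have dw := fun i => differentiableAt_of_slab (h.contDiff_w i) h0 hq.2
  have dp := differentiableAt_of_slab h.contDiff_p h0 hq.2
  have db := fun i => differentiableAt_of_slab (h.contDiff_b i) h0 hq.2
  have hr := (h.pos q hq).ne'
  have hw : ∀ i, dir tvec (w i) q = -(∑ j, w j q * dir (xvec j) (w i) q)
      - (r q)⁻¹ * dir (xvec i) p q
      + ∑ j, b j q * (μ⁻¹ * (r q)⁻¹ * (dir (xvec j) (b i) q - dir (xvec i) (b j) q)) := by
    intro i
    refine mul_left_cancel₀ hr ?_
    rw [h.momentum q hq h0 i]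
    simp only [Fin.sum_univ_three]
    field_simp
  rw [dir_energy dr dw dp db, h.mass q hq h0, h.pressure q hq h0]
  simp_rw [fun i => h.induction q hq h0 i, hw, fun j => dir_mul (v := xvec j) (dp.sub_const pb) (dw j),
    dir_sub_const]
  simp only [Fin.sum_univ_three]
  have hinv : r q * (r q)⁻¹ = 1 := mul_inv_cancel₀ hr
  -- The relation γ p̄ = 1 cancels the linear terms in the divergence of w: r and p then have the
  -- same linearised equation, so r - p is stationary to first order. The pressure work leaves a
  -- factor 1 - 1/r, again a perturbation.
  linear_combination ((r q - p q - (1 - pb)) - (p q - pb)) * (dir (xvec 0) (w 0) q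
    + dir (xvec 1) (w 1) q + dir (xvec 2) (w 2) q) * hpb - (w 0 q * dir (xvec 0) p q
    + w 1 q * dir (xvec 1) p q + w 2 q * dir (xvec 2) p q) * hinv

/-- Every term of `energy_balance` contains two perturbation factors, each bounded by a multiple of
the square root of the energy, times coefficients bounded on the cylinder. The constant depends on
the solution, which is harmless: it only enters Grönwall's inequality with zero initial value. -/
lemma energy_balance_isBigO (h : ScalarSolution γ μ T r w p s b) (hpb : γ * pb = 1) {t₁ : ℝ}
    (ht₁ : (t₁ : EReal) < T) (R : ℝ) (x₀ : E3) :
    (fun q => dir tvec (energy pb r w p b) q + ∑ j, dir (xvec j) (fun q => (p q - pb) * w j q) q)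
      =O[𝓟 {q : ℝ × E3 | 0 < q.1 ∧ q.1 ≤ t₁ ∧ q.2 ∈ Metric.closedBall x₀ R}]
        energy pb r w p b := by
  set K := {q : ℝ × E3 | 0 < q.1 ∧ q.1 ≤ t₁ ∧ q.2 ∈ Metric.closedBall x₀ R} with hK
  set m : ℝ × E3 → ℝ := fun q => Real.sqrt (energy pb r w p b q) with hm
  have hKs : ∀ q ∈ K, q ∈ slab T := fun q hq => mem_slab_of_le ht₁ hq.1.le hq.2.1
  have bdd : ∀ {f : ℝ × E3 → ℝ}, (∃ C, ∀ q ∈ K, ‖f q‖ ≤ C) →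
      f =O[𝓟 K] (fun _ => (1 : ℝ)) := fun {f} ⟨C, hC⟩ =>
    isBigO_principal.2 ⟨C, fun q hq => by simpa using hC q hq⟩
  have bd : ∀ {f : ℝ × E3 → ℝ} (v : ℝ × E3), ContDiffOn ℝ 1 f (slab T) →
      dir v f =O[𝓟 K] (fun _ => (1 : ℝ)) := fun {f} v hf => by
    obtain ⟨C, hC⟩ := exists_bound_dir_of_slab hf v ht₁ R x₀
    exact bdd ⟨C, fun q hq => hC q hq.1 hq.2.1 hq.2.2⟩
  have bc : ∀ c : ℝ, (fun _ : ℝ × E3 => c) =O[𝓟 K] (fun _ => (1 : ℝ)) := fun c =>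
    bdd ⟨‖c‖, fun _ _ => le_rfl⟩
  have br : (fun q => (r q)⁻¹) =O[𝓟 K] (fun _ => (1 : ℝ)) := by
    obtain ⟨C, hC⟩ := exists_bound_of_slab
      (h.contDiff_r.continuousOn.inv₀ fun q hq => (h.pos q hq).ne') ht₁ R x₀
    exact bdd ⟨C, fun q hq => hC q hq.1.le hq.2.1 hq.2.2⟩
  have mul1 : ∀ {f g : ℝ × E3 → ℝ}, f =O[𝓟 K] (fun _ => (1 : ℝ)) →
      g =O[𝓟 K] (fun _ => (1 : ℝ)) → (fun q => f q * g q) =O[𝓟 K] (fun _ => (1 : ℝ)) :=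
    fun hf hg => by simpa using hf.mul hg
  have mulm : ∀ {f g : ℝ × E3 → ℝ}, f =O[𝓟 K] m →
      g =O[𝓟 K] (fun _ => (1 : ℝ)) → (fun q => f q * g q) =O[𝓟 K] m :=
    fun hf hg => by simpa using hf.mul hg
  have mul2 : ∀ {f g : ℝ × E3 → ℝ}, f =O[𝓟 K] m →
      g =O[𝓟 K] m → (fun q => f q * g q) =O[𝓟 K] energy pb r w p b :=
    fun hf hg => (hf.mul hg).congr_right fun q => Real.mul_self_sqrt (energy_nonneg q)
  have sq_le : ∀ {f : ℝ × E3 → ℝ}, (∀ q, f q ^ 2 ≤ 2 * energy pb r w p b q) → f =O[𝓟 K] m :=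
    fun {f} hf => isBigO_principal.2 ⟨Real.sqrt 2, fun q _ => by
      rw [Real.norm_of_nonneg (Real.sqrt_nonneg _), ← Real.sqrt_mul (by norm_num)]
      exact Real.abs_le_sqrt (hf q)⟩
  have hp : (fun q => p q - pb) =O[𝓟 K] m := sq_le fun q => by
    have h1 : 0 ≤ ∑ i, w i q ^ 2 := Finset.sum_nonneg fun i _ => sq_nonneg _
    have h2 : 0 ≤ ∑ i, b i q ^ 2 := Finset.sum_nonneg fun i _ => sq_nonneg _
    unfold energy
    nlinarith [sq_nonneg (r q - p q - (1 - pb))]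
  have hθ : (fun q => r q - p q - (1 - pb)) =O[𝓟 K] m := sq_le fun q => by
    have h1 : 0 ≤ ∑ i, w i q ^ 2 := Finset.sum_nonneg fun i _ => sq_nonneg _
    have h2 : 0 ≤ ∑ i, b i q ^ 2 := Finset.sum_nonneg fun i _ => sq_nonneg _
    unfold energy
    nlinarith [sq_nonneg (p q - pb)]
  have hw : ∀ i, w i =O[𝓟 K] m := fun i => sq_le fun q => by
    have h1 : w i q ^ 2 ≤ ∑ i, w i q ^ 2 :=
      Finset.single_le_sum (f := fun i => w i q ^ 2) (fun i _ => sq_nonneg _) (Finset.mem_univ i)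
    have h2 : 0 ≤ ∑ i, b i q ^ 2 := Finset.sum_nonneg fun i _ => sq_nonneg _
    unfold energy
    nlinarith [sq_nonneg (p q - pb), sq_nonneg (r q - p q - (1 - pb))]
  have hb : ∀ i, b i =O[𝓟 K] m := fun i => sq_le fun q => by
    have h1 : b i q ^ 2 ≤ ∑ i, b i q ^ 2 :=
      Finset.single_le_sum (f := fun i => b i q ^ 2) (fun i _ => sq_nonneg _) (Finset.mem_univ i)
    have h2 : 0 ≤ ∑ i, w i q ^ 2 := Finset.sum_nonneg fun i _ => sq_nonneg _
    unfold energy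
    nlinarith [sq_nonneg (p q - pb), sq_nonneg (r q - p q - (1 - pb))]
  have dr := fun v => bd v h.contDiff_r
  have dp := fun v => bd v h.contDiff_p
  have dw := fun v i => bd v (h.contDiff_w i)
  have db := fun v i => bd v (h.contDiff_b i)
  -- The nesting copies the right side of `energy_balance` term by term.
  have main := (((mul2 hp (IsBigO.sum (s := Finset.univ) fun j _ => (mulm (hw j) (dp (xvec j))).add
      (mulm hp (mul1 (bc γ) (dw (xvec j) j)))).neg_left).add
    (IsBigO.sum (s := Finset.univ) fun i _ => mul2 (hw i)
      (((mulm (hθ.add hp) (mul1 br (dp (xvec i)))).sub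
        (IsBigO.sum (s := Finset.univ) fun j _ => mulm (hw j) (dw (xvec j) i))).add
        (IsBigO.sum (s := Finset.univ) fun j _ => mulm (hb j) (mul1 (mul1 (bc μ⁻¹) br)
          ((db (xvec j) i).sub (db (xvec i) j))))))).add
    (IsBigO.sum (s := Finset.univ) fun i _ => mul2 (hb i)
      (IsBigO.sum (s := Finset.univ) fun j _ => (((mulm (hw i) (db (xvec j) j)).add
        (mulm (hb j) (dw (xvec j) i))).sub (mulm (hw j) (db (xvec j) i))).sub
        (mulm (hb i) (dw (xvec j) j))))).add
    (mul2 hθ (IsBigO.sum (s := Finset.univ) fun j _ =>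
      (mulm (hw j) ((dp (xvec j)).sub (dr (xvec j)))).add
        (mulm ((hp.const_mul_left γ).sub (hθ.add hp)) (dw (xvec j) j))))
  refine main.congr' ?_ EventuallyEq.rfl
  filter_upwards [mem_principal_self K] with q hq
  exact (energy_balance h hpb (hKs q hq) hq.1).symm

end Energy

/-! ### Cutoffs, backward cones and finite speed of propagation -/

lemma hasDerivAt_max_zero_sq (y : ℝ) :
    HasDerivAt (fun y : ℝ => max 0 y ^ 2) (2 * max 0 y) y := by
  rcases lt_trichotomy y 0 with hy | rfl | hy
  · rw [max_eq_left hy.le, mul_zero]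
    refine (hasDerivAt_const y (0 : ℝ)).congr_of_eventuallyEq ?_
    filter_upwards [Iio_mem_nhds hy] with z hz
    rw [max_eq_left (le_of_lt hz)]
    norm_num
  · simp only [max_self, mul_zero]
    rw [hasDerivAt_iff_isLittleO]
    simp only [max_self, sub_zero, smul_zero, ne_eq, OfNat.ofNat_ne_zero, not_false_eq_true,
      zero_pow]
    refine (IsBigO.of_bound 1 ?_).trans_isLittleO
      (g := fun y : ℝ => y ^ 2) (by simpa using isLittleO_pow_id (𝕜 := ℝ) (n := 2) (by norm_num))
    refine Eventually.of_forall fun z => ?_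
    rw [one_mul, norm_pow, norm_pow]
    gcongr
    rcases le_total z 0 with h | h
    · simp [max_eq_left h]
    · simp [max_eq_right h]
  · rw [max_eq_right hy.le]
    refine HasDerivAt.congr_of_eventuallyEq (f := fun y => y ^ 2) ?_ ?_
    · simpa using hasDerivAt_pow 2 y
    · filter_upwards [Ioi_mem_nhds hy] with z hz
      rw [max_eq_right (le_of_lt hz)]

/-- Squaring the positive part is enough to stay C¹. The same truncation serves as the weight on
cones and in the minimum principle for the entropy. -/
lemma contDiff_max_zero_sq : ContDiff ℝ 1 (fun y : ℝ => max 0 y ^ 2) := by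
  rw [contDiff_one_iff_deriv]
  refine ⟨fun y => (hasDerivAt_max_zero_sq y).differentiableAt, ?_⟩
  have : deriv (fun y : ℝ => max 0 y ^ 2) = fun y => 2 * max 0 y :=
    funext fun y => (hasDerivAt_max_zero_sq y).deriv
  rw [this]
  fun_prop

/-- A defining function of the backward cone with vertex `(R, x₀)`. -/
def coneFn (R : ℝ) (x₀ : E3) (q : ℝ × E3) : ℝ := (R - q.1) ^ 2 - ∑ i, (q.2 i - x₀ i) ^ 2

lemma norm_sub_sq_eq_sum (x y : E3) : ‖x - y‖ ^ 2 = ∑ i, (x i - y i) ^ 2 := by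
  rw [EuclideanSpace.norm_sq_eq]
  simp

lemma contDiff_coneFn (R : ℝ) (x₀ : E3) : ContDiff ℝ 1 (coneFn R x₀) := by
  unfold coneFn
  fun_prop

lemma dir_coneFn (R : ℝ) (x₀ : E3) (q v : ℝ × E3) :
    dir v (coneFn R x₀) q = -2 * (R - q.1) * v.1 - ∑ i, 2 * ((q.2 i - x₀ i) * v.2 i) := by
  have h1 : ∀ i, HasFDerivAt (fun q : ℝ × E3 => q.2 i - x₀ i)
      ((PiLp.proj 2 (𝕜 := ℝ) (fun _ : Fin 3 => ℝ) i).comp (ContinuousLinearMap.snd ℝ ℝ E3)) q :=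
    fun i => ((PiLp.proj 2 (𝕜 := ℝ) (fun _ : Fin 3 => ℝ) i).comp
      (ContinuousLinearMap.snd ℝ ℝ E3)).hasFDerivAt.sub_const (x₀ i)
  have h2 : HasFDerivAt (fun q : ℝ × E3 => R - q.1) (-(ContinuousLinearMap.fst ℝ ℝ E3)) q :=
    (hasFDerivAt_fst).const_sub R
  have h3 := (h2.pow 2).sub (HasFDerivAt.fun_sum (u := Finset.univ) fun i _ => (h1 i).pow 2)
  have h4 : HasFDerivAt (coneFn R x₀) _ q := h3
  rw [dir, h4.fderiv]
  simp [Fin.sum_univ_three]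
  ring

lemma dir_tvec_coneFn (R : ℝ) (x₀ : E3) (q : ℝ × E3) :
    dir tvec (coneFn R x₀) q = -2 * (R - q.1) := by
  simp [dir_coneFn, tvec]

lemma dir_xvec_coneFn (R : ℝ) (x₀ : E3) (q : ℝ × E3) (j : Fin 3) :
    dir (xvec j) (coneFn R x₀) q = -2 * (q.2 j - x₀ j) := by
  rw [dir_coneFn]
  fin_cases j <;> simp [xvec]

/-- A momentum-type flux is dominated by the energy along directions of length at most `ℓ`. -/
lemma flux_le {P ℓ : ℝ} (hℓ : 0 ≤ ℓ) (W Y : Fin 3 → ℝ) (hY : ∑ i, Y i ^ 2 ≤ ℓ ^ 2) :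
    -(P * ∑ i, W i * Y i) ≤ 2⁻¹ * (P ^ 2 + ∑ i, W i ^ 2) * ℓ := by
  have hcs := Finset.sum_mul_sq_le_sq_mul_sq Finset.univ W Y
  set a := ∑ i, W i * Y i
  set n := ∑ i, W i ^ 2
  have hn : 0 ≤ n := Finset.sum_nonneg fun i _ => sq_nonneg _
  have h1 : |a| ≤ Real.sqrt n * ℓ := by
    rw [← Real.sqrt_sq hℓ, ← Real.sqrt_mul hn]
    exact Real.abs_le_sqrt (hcs.trans (mul_le_mul_of_nonneg_left hY hn))
  have h2 : -(P * a) ≤ |P| * |a| := by rw [← abs_mul]; exact neg_le_abs _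
  have h3 : |P| * |a| ≤ |P| * (Real.sqrt n * ℓ) := mul_le_mul_of_nonneg_left h1 (abs_nonneg P)
  have h4 : |P| * Real.sqrt n ≤ 2⁻¹ * (P ^ 2 + n) := by
    nlinarith [sq_nonneg (|P| - Real.sqrt n), Real.sq_sqrt hn, sq_abs P]
  calc -(P * a) ≤ |P| * Real.sqrt n * ℓ := by linarith [mul_assoc |P| (Real.sqrt n) ℓ]
    _ ≤ _ := mul_le_mul_of_nonneg_right h4 hℓ

section Propagation

variable {γ μ : ℝ} {T : EReal} {r p s : ℝ × E3 → ℝ} {w b : Fin 3 → ℝ × E3 → ℝ} {pb : ℝ}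

/-- Finite speed of propagation: the perturbation stays in the ball of radius `1 + t`. -/
theorem eq_const_of_one_add_lt_norm (h : ScalarSolution γ μ T r w p s b) (hpb : γ * pb = 1)
    (hinit : ∀ x, 1 < ‖x‖ → energy pb r w p b (0, x) = 0) {q₁ : ℝ × E3} (hq₁ : q₁ ∈ slab T)
    (hx : 1 + q₁.1 < ‖q₁.2‖) : energy pb r w p b q₁ = 0 := by
  obtain ⟨t, x₀⟩ := q₁
  simp only at hx
  have ht0 : 0 ≤ t := hq₁.1
  have htT : (t : EReal) < T := hq₁.2
  -- With this radius the base of the cone at time 0 misses the unit ball, and the vertex time R is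
  -- still later than t.
  set R := ‖x₀‖ - 1 with hR
  have htR : t < R := by linarith
  -- Past the vertex `coneFn` is positive again inside the reflected cone, so time is cut off at R.
  set T' : EReal := min T R with hT'
  have htT' : (t : EReal) < T' := lt_min htT (EReal.coe_lt_coe_iff.2 htR)
  have hsub : slab T' ⊆ slab T := fun q hq => ⟨hq.1, hq.2.trans_le (min_le_left _ _)⟩
  have hltR : ∀ q ∈ slab T', q.1 < R := fun q hq =>
    EReal.coe_lt_coe_iff.1 (hq.2.trans_le (min_le_right _ _))
  set η := energy pb r w p b with hη
  set χ : ℝ × E3 → ℝ := fun q => max 0 (coneFn R x₀ q) ^ 2 with hχ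
  have cχ : ContDiff ℝ 1 χ := contDiff_max_zero_sq.comp (contDiff_coneFn R x₀)
  have dχ : ∀ q v, dir v χ q = 2 * max 0 (coneFn R x₀ q) * dir v (coneFn R x₀) q := fun q v =>
    dir_comp (φ := fun y => max 0 y ^ 2) (hasDerivAt_max_zero_sq _)
      ((contDiff_coneFn R x₀).differentiable (by norm_num) q)
  have hcone : ∀ q : ℝ × E3, 0 ≤ q.1 → q.1 < R → q.2 ∉ Metric.ball x₀ R → coneFn R x₀ q ≤ 0 := by
    intro q h0 h1 h2
    rw [Metric.mem_ball, dist_eq_norm, not_lt] at h2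
    rw [coneFn, ← norm_sub_sq_eq_sum]
    nlinarith
  have ca : ContDiffOn ℝ 1 (fun q => η q * χ q) (slab T') :=
    ((contDiffOn_energy h).mono hsub).mul cχ.contDiffOn
  have cf : ∀ j, ContDiffOn ℝ 1 (fun q => (p q - pb) * w j q) (slab T) := fun j =>
    (h.contDiff_p.sub contDiffOn_const).mul (h.contDiff_w j)
  have cb : ∀ j, ContDiffOn ℝ 1 (fun q => ((p q - pb) * w j q) * χ q) (slab T') := fun j =>
    ((cf j).mono hsub).mul cχ.contDiffOn
  have hsupp : ∀ t₁ : ℝ, (t₁ : EReal) < T' → ∃ ρ : ℝ, ∀ q : ℝ × E3, 0 ≤ q.1 → q.1 ≤ t₁ →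
      ρ < ‖q.2‖ → η q * χ q = 0 ∧ ∀ j, ((p q - pb) * w j q) * χ q = 0 := by
    intro t₁ ht₁
    refine ⟨‖x₀‖ + R, fun q h0 h1 h2 => ?_⟩
    have hz : χ q = 0 := by
      have := hcone q h0 (hltR q (mem_slab_of_le ht₁ h0 h1)) (by
        rw [Metric.mem_ball, dist_eq_norm, not_lt]
        linarith [norm_sub_norm_le q.2 x₀])
      simp [hχ, max_eq_left this]
    simp [hz]
  obtain ⟨C, hC⟩ := isBigO_principal.1 (energy_balance_isBigO h hpb htT R x₀)
  have hle : ∀ τ ∈ Ioo 0 t, ∀ x : E3, dir tvec (fun q => η q * χ q) (τ, x)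
      + ∑ j, dir (xvec j) (fun q => ((p q - pb) * w j q) * χ q) (τ, x)
      ≤ C * (η (τ, x) * χ (τ, x)) := by
    intro τ hτ x
    set q : ℝ × E3 := (τ, x) with hq
    have hτR : τ < R := hτ.2.trans htR
    have hqs : q ∈ slab T := mem_slab_of_le htT hτ.1.le hτ.2.le
    have dη : DifferentiableAt ℝ η q := differentiableAt_of_slab (contDiffOn_energy h) hτ.1 hqs.2
    have df := fun j => differentiableAt_of_slab (cf j) (q := q) hτ.1 hqs.2
    have dc : DifferentiableAt ℝ χ q := cχ.differentiable (by norm_num) q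
    rw [dir_mul dη dc]
    simp_rw [fun j => dir_mul (v := xvec j) (df j) dc, dχ, dir_tvec_coneFn, dir_xvec_coneFn]
    by_cases hx : x ∈ Metric.ball x₀ R
    · have e1 := (le_abs_self _).trans (hC q ⟨hτ.1, hτ.2.le, Metric.ball_subset_closedBall hx⟩)
      rw [Real.norm_of_nonneg (energy_nonneg q)] at e1
      have e2 : 0 ≤ χ q := sq_nonneg _
      have e3 := mul_le_mul_of_nonneg_right e1 e2
      -- Up to the factor -4 this is the derivative of the weight against energy and flux. Inside
      -- the cone |x - x₀| ≤ R - τ, so `flux_le` lets the energy term absorb the flux: the cone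
      -- shrinks at least as fast as signals travel.
      have e4 : 0 ≤ max 0 (coneFn R x₀ q) * (η q * (R - τ)
          + (p q - pb) * ∑ j, w j q * (x j - x₀ j)) := by
        rcases le_or_gt (coneFn R x₀ q) 0 with hc | hc
        · simp [max_eq_left hc]
        · refine mul_nonneg (le_max_left _ _) ?_
          have hf := flux_le (P := p q - pb) (ℓ := R - τ) (by linarith) (fun j => w j q)
            (fun j => x j - x₀ j) (by
              have : coneFn R x₀ q = (R - τ) ^ 2 - ∑ i, (x i - x₀ i) ^ 2 := rfl
              linarith)
          have hE : 2⁻¹ * ((p q - pb) ^ 2 + ∑ i, w i q ^ 2) * (R - τ) ≤ η q * (R - τ) := by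
            refine mul_le_mul_of_nonneg_right ?_ (by linarith)
            have : 0 ≤ ∑ i, b i q ^ 2 := Finset.sum_nonneg fun i _ => sq_nonneg _
            rw [hη, energy]
            nlinarith [sq_nonneg (r q - p q - (1 - pb))]
          linarith
      have e5 : q.1 = τ := rfl
      have e6 : q.2 = x := rfl
      simp only [Fin.sum_univ_three, e5, e6] at e3 e4 ⊢
      nlinarith
    · have hz := hcone q hτ.1.le hτR hx
      simp [hχ, max_eq_left hz]
  have hG : ∫ x, η (t, x) * χ (t, x) ≤ 0 := by
    refine nonpos_of_deriv_le_mul (C := C) (f := fun t => ∫ x, η (t, x) * χ (t, x)) ht0 ?_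
      (fun τ hτ => (hasDerivAt_integral_balance ca cb hsupp hτ.1
        ((EReal.coe_lt_coe_iff.2 hτ.2).trans htT')).2) ?_ ?_
    · refine (continuousOn_integral_slice ca.continuousOn fun t₁ h1 => ?_).mono fun τ hτ =>
        mem_slab_of_le (q := (τ, (0 : E3))) htT' hτ.1 hτ.2
      obtain ⟨ρ, hρ⟩ := hsupp t₁ h1
      exact ⟨ρ, fun q a b c => (hρ q a b c).1⟩
    · intro τ hτ
      have hτT : (τ : EReal) < T' := (EReal.coe_lt_coe_iff.2 hτ.2).trans htT'
      rw [← integral_const_mul]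
      refine integral_mono (hasDerivAt_integral_balance ca cb hsupp hτ.1 hτT).1 ?_ (hle τ hτ)
      obtain ⟨ρ, hρ⟩ := hsupp τ hτT
      exact (integrable_slice ca.continuousOn hτ.1.le hτT (fun x hx =>
        (hρ (τ, x) hτ.1.le le_rfl hx).1)).const_mul C
    · refine le_of_eq ?_
      refine (integral_congr_ae (Eventually.of_forall fun x => ?_)).trans (integral_zero E3 ℝ)
      by_cases hx : x ∈ Metric.ball x₀ R
      · have : 1 < ‖x‖ := by
          rw [Metric.mem_ball, dist_eq_norm, norm_sub_rev] at hx
          linarith [norm_sub_norm_le x₀ x]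
        simp only [hinit x this, zero_mul]
      · have hz := hcone (0, x) le_rfl (by simpa using ht0.trans_lt htR) hx
        simp [hχ, max_eq_left hz]
  have hcont : Continuous (fun x => η (t, x) * χ (t, x)) :=
    continuous_slice ca.continuousOn ht0 htT'
  have hnn : ∀ x, 0 ≤ η (t, x) * χ (t, x) := fun x =>
    mul_nonneg (energy_nonneg _) (sq_nonneg _)
  have hint : Integrable (fun x => η (t, x) * χ (t, x)) := by
    obtain ⟨ρ, hρ⟩ := hsupp t htT'
    exact integrable_slice ca.continuousOn ht0 htT' (fun x hx => (hρ (t, x) ht0 le_rfl hx).1)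
  have hzero : (fun x => η (t, x) * χ (t, x)) = fun _ => 0 := by
    refine (hcont.ae_eq_iff_eq volume continuous_const).1 ?_
    exact (integral_eq_zero_iff_of_nonneg hnn hint).1 (le_antisymm hG (integral_nonneg hnn))
  have h1 := congrFun hzero x₀
  have h2 : 0 < χ (t, x₀) := by
    have : coneFn R x₀ (t, x₀) = (R - t) ^ 2 := by simp [coneFn]
    simp only [hχ, this]
    rw [max_eq_right (sq_nonneg _)]
    have : 0 < R - t := by linarith
    positivity
  exact (mul_eq_zero.1 h1).resolve_right h2.ne'

end Propagation

/-! ### The test function and its derivatives -/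

/-- The surface measure on the unit sphere. -/
abbrev surf : Measure (Metric.sphere (0 : E3) 1) := (volume : Measure E3).toSphere

/-- The exponential integral over the unit sphere with weight `g`. -/
def sphInt (g : E3 → ℝ) (x : E3) : ℝ :=
  ∫ ω : Metric.sphere (0 : E3) 1, g ω * Real.exp (inner ℝ (ω : E3) x) ∂surf

lemma F_eq_sphInt : F = sphInt fun _ => 1 := by
  ext x
  simp [F, sphInt]

lemma integrable_surf {f : Metric.sphere (0 : E3) 1 → ℝ} (hf : Continuous f) :
    Integrable f surf :=
  hf.integrable_of_hasCompactSupport (HasCompactSupport.of_compactSpace f)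

lemma integrable_sphInt {g : E3 → ℝ} (hg : Continuous g) (x : E3) :
    Integrable (fun ω : Metric.sphere (0 : E3) 1 => g ω * Real.exp (inner ℝ (ω : E3) x)) surf :=
  integrable_surf (by fun_prop)

lemma norm_of_sphere (ω : Metric.sphere (0 : E3) 1) : ‖(ω : E3)‖ = 1 := by
  simp

lemma hasFDerivAt_sphInt {g : E3 → ℝ} (hg : Continuous g) (x : E3) :
    HasFDerivAt (sphInt g) (∫ ω : Metric.sphere (0 : E3) 1,
      (g ω * Real.exp (inner ℝ (ω : E3) x)) • innerSL ℝ (ω : E3) ∂surf) x := by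
  obtain ⟨M, hM⟩ := (isCompact_sphere (0 : E3) 1).exists_bound_of_continuousOn hg.continuousOn
  refine hasFDerivAt_integral_of_dominated_of_fderiv_le
    (bound := fun _ => M * Real.exp (‖x‖ + 1))
    (F' := fun x (ω : Metric.sphere (0 : E3) 1) =>
      (g ω * Real.exp (inner ℝ (ω : E3) x)) • innerSL ℝ (ω : E3))
    (Metric.ball_mem_nhds x one_pos) ?_ (integrable_sphInt hg x) ?_ ?_ (integrable_const _) ?_
  · exact Eventually.of_forall fun y => (integrable_sphInt hg y).aestronglyMeasurable
  · exact Continuous.aestronglyMeasurable (by fun_prop)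
  · refine Eventually.of_forall fun ω y hy => ?_
    have h1 : ‖g ω‖ ≤ M := hM ω ω.2
    have h2 : inner ℝ (ω : E3) y ≤ ‖x‖ + 1 := by
      refine (real_inner_le_norm _ _).trans ?_
      rw [norm_of_sphere, one_mul]
      rw [Metric.mem_ball, dist_eq_norm] at hy
      linarith [norm_sub_norm_le y x]
    rw [norm_smul, innerSL_apply_norm, norm_of_sphere, mul_one, norm_mul,
      Real.norm_of_nonneg (Real.exp_pos _).le]
    exact mul_le_mul h1 (Real.exp_le_exp.2 h2) (Real.exp_pos _).le ((norm_nonneg _).trans h1)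
  · refine Eventually.of_forall fun ω y _ => ?_
    have h := (((innerSL ℝ (ω : E3)).hasFDerivAt (x := y)).exp).const_mul (g ω)
    rw [smul_smul] at h
    exact h

lemma differentiable_sphInt {g : E3 → ℝ} (hg : Continuous g) : Differentiable ℝ (sphInt g) :=
  fun x => (hasFDerivAt_sphInt hg x).differentiableAt

/-- Differentiation only multiplies the weight by a coordinate of ω. This is why `sphInt` carries a
weight: the family is closed under derivatives, and regularity of F and its gradient comes from one
lemma. -/
lemma pd_sphInt {g : E3 → ℝ} (hg : Continuous g) (i : Fin 3) :
    pd i (sphInt g) = sphInt fun ω => g ω * ω i := by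
  ext x
  rw [pd, (hasFDerivAt_sphInt hg x).fderiv, ContinuousLinearMap.integral_apply]
  · refine integral_congr_ae (Eventually.of_forall fun ω => ?_)
    simp [EuclideanSpace.inner_single_right]
    ring
  · obtain ⟨M, hM⟩ := (isCompact_univ (X := Metric.sphere (0 : E3) 1)).exists_bound_of_continuousOn
      (f := fun ω : Metric.sphere (0 : E3) 1 =>
        (g ω * Real.exp (inner ℝ (ω : E3) x)) • innerSL ℝ (ω : E3)) (by fun_prop)
    exact Integrable.of_bound (C := M) (Continuous.aestronglyMeasurable (by fun_prop))
      (Eventually.of_forall fun ω => hM ω (mem_univ _))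

lemma fderiv_eq_sum_pd (f : E3 → ℝ) (x : E3) :
    fderiv ℝ f x = ∑ i, pd i f x • PiLp.proj 2 (𝕜 := ℝ) (fun _ : Fin 3 => ℝ) i := by
  ext v
  have h : v = ∑ i, v i • EuclideanSpace.single i (1 : ℝ) := by
    ext j
    fin_cases j <;> simp [Fin.sum_univ_three]
  conv_lhs => rw [h]
  simp [Fin.sum_univ_three, pd]
  ring

lemma contDiff_sphInt {g : E3 → ℝ} (hg : Continuous g) : ContDiff ℝ 1 (sphInt g) := by
  rw [contDiff_one_iff_fderiv]
  refine ⟨differentiable_sphInt hg, ?_⟩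
  rw [show fderiv ℝ (sphInt g) = _ from funext (fderiv_eq_sum_pd (sphInt g))]
  refine continuous_finsetSum _ fun i _ => ?_
  rw [pd_sphInt hg]
  exact (differentiable_sphInt (hg.mul (by fun_prop))).continuous.smul continuous_const

/-- The first derivatives of `F`. -/
lemma pd_F (i : Fin 3) : pd i F = sphInt fun ω => ω i := by
  rw [F_eq_sphInt, pd_sphInt continuous_const]
  simp

/-- The second derivatives of `F`. -/
lemma pd_pd_F (i j : Fin 3) : pd j (pd i F) = sphInt fun ω => ω i * ω j := by
  rw [pd_F, pd_sphInt (by fun_prop)]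

lemma contDiff_F : ContDiff ℝ 1 F := by
  rw [F_eq_sphInt]
  exact contDiff_sphInt continuous_const

lemma contDiff_pd_F (i : Fin 3) : ContDiff ℝ 1 (pd i F) := by
  rw [pd_F]
  exact contDiff_sphInt (by fun_prop)

lemma sum_sq_of_sphere (ω : Metric.sphere (0 : E3) 1) : ∑ i, (ω : E3) i ^ 2 = 1 := by
  rw [← sub_zero (ω : E3)]
  have := norm_sub_sq_eq_sum (ω : E3) 0
  simp at this
  simpa using this.symm

/-- `F` is an eigenfunction of the Laplacian. -/
lemma laplacian_F (x : E3) : ∑ i, pd i (pd i F) x = F x := by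
  simp_rw [pd_pd_F]
  unfold sphInt
  rw [← integral_finsetSum _ fun i _ => integrable_sphInt (g := fun ω => ω i * ω i) (by fun_prop) x,
    F]
  refine integral_congr_ae (Eventually.of_forall fun ω => ?_)
  have := sum_sq_of_sphere ω
  simp only [← Finset.sum_mul]
  simp only [Fin.sum_univ_three] at this ⊢
  linear_combination Real.exp (inner ℝ (ω : E3) x) * this

/-- Two derivatives of exp (ω · x) along v bring down the square (ω · v)². Both the sign of the
Hessian and its upper bound are read off from this form. -/
lemma hessian_F (x v : E3) : ∑ i, ∑ j, v i * v j * pd j (pd i F) x =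
    sphInt (fun ω => inner ℝ ω v ^ 2) x := by
  simp_rw [pd_pd_F]
  unfold sphInt
  simp_rw [← integral_const_mul]
  have hi : ∀ i j : Fin 3, Integrable (fun ω : Metric.sphere (0 : E3) 1 => v i * v j *
      ((ω : E3) i * (ω : E3) j * Real.exp (inner ℝ (ω : E3) x))) surf := fun i j =>
    integrable_surf (by fun_prop)
  simp_rw [fun i => (integral_finsetSum Finset.univ fun j _ => hi i j).symm]
  rw [← integral_finsetSum _ fun i _ => integrable_finsetSum _ fun j _ => hi i j]
  refine integral_congr_ae (Eventually.of_forall fun ω => ?_)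
  simp only [Fin.sum_univ_three, inner_eq_sum]
  ring

lemma hessian_F_nonneg (x v : E3) : 0 ≤ ∑ i, ∑ j, v i * v j * pd j (pd i F) x := by
  rw [hessian_F]
  exact integral_nonneg fun ω => mul_nonneg (sq_nonneg _) (Real.exp_pos _).le

lemma F_pos (x : E3) : 0 < F x := by
  rw [F]
  have hi : Integrable (fun ω : Metric.sphere (0 : E3) 1 => Real.exp (inner ℝ (ω : E3) x)) surf :=
    integrable_surf (by fun_prop)
  have : NeZero surf := ⟨Measure.toSphere_ne_zero (volume : Measure E3)⟩
  exact integral_exp_pos hi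

/-! ### Rotational symmetry and the tangential Hessian -/

/-- The action of a linear isometry on the unit sphere. -/
def sphereMap (L : E3 ≃ₗᵢ[ℝ] E3) :
    Metric.sphere (0 : E3) 1 ≃ₜ Metric.sphere (0 : E3) 1 where
  toFun ω := ⟨L ω, by simp⟩
  invFun ω := ⟨L.symm ω, by simp⟩
  left_inv ω := by simp
  right_inv ω := by simp
  continuous_toFun := by fun_prop
  continuous_invFun := by fun_prop

-- The surface measure of a set is defined through the volume of the cone over it, and a linear
-- isometry maps cones to cones and preserves volume.
open scoped Pointwise in
lemma measurePreserving_sphereMap (L : E3 ≃ₗᵢ[ℝ] E3) :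
    MeasurePreserving (sphereMap L) surf surf := by
  refine ⟨(sphereMap L).continuous.measurable, ?_⟩
  ext s hs
  rw [Measure.map_apply (sphereMap L).continuous.measurable hs, surf,
    Measure.toSphere_apply' _ hs,
    Measure.toSphere_apply' _ ((sphereMap L).continuous.measurable hs)]
  congr 1
  have h : Ioo (0 : ℝ) 1 • (Subtype.val '' (sphereMap L ⁻¹' s)) =
      L ⁻¹' (Ioo (0 : ℝ) 1 • (Subtype.val '' s)) := by
    ext y
    simp only [Set.mem_smul, mem_image, mem_preimage]
    constructor
    · rintro ⟨c, hc, _, ⟨ω, hω, rfl⟩, rfl⟩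
      exact ⟨c, hc, _, ⟨_, hω, rfl⟩, by simp [sphereMap]⟩
    · rintro ⟨c, hc, _, ⟨ω, hω, rfl⟩, h⟩
      refine ⟨c, hc, _, ⟨(sphereMap L).symm ω, by simpa using hω, rfl⟩, ?_⟩
      apply L.injective
      rw [← h]
      simp [sphereMap]
  rw [h]
  exact L.measurePreserving.measure_preimage_equiv (f := L.toHomeomorph.toMeasurableEquiv) _

lemma integral_surf_comp (L : E3 ≃ₗᵢ[ℝ] E3) (f : E3 → ℝ) :
    ∫ ω : Metric.sphere (0 : E3) 1, f (L ω) ∂surf =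
      ∫ ω : Metric.sphere (0 : E3) 1, f ω ∂surf :=
  (measurePreserving_sphereMap L).integral_comp (sphereMap L).measurableEmbedding
    (fun ω => f ω)

/-- A vector orthogonal to two given ones. -/
lemma exists_orthogonal (x v : E3) : ∃ y : E3, ‖y‖ = 1 ∧ inner ℝ y x = 0 ∧ inner ℝ y v = 0 := by
  have h : (Submodule.span ℝ {x, v})ᗮ ≠ ⊥ := by
    intro hbot
    have h1 := Submodule.finrank_add_finrank_orthogonal (Submodule.span ℝ {x, v})
    rw [hbot, finrank_bot, finrank_euclideanSpace_fin] at h1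
    have h2 : Module.finrank ℝ (Submodule.span ℝ ({x, v} : Set E3)) ≤ 2 := by
      classical
      have := finrank_span_finset_le_card (R := ℝ) ({x, v} : Finset E3)
      rw [Finset.coe_pair] at this
      exact this.trans Finset.card_le_two
    omega
  obtain ⟨y, hy, hy0⟩ := Submodule.exists_mem_ne_zero_of_ne_bot h
  have hx := Submodule.inner_left_of_mem_orthogonal (Submodule.subset_span (by simp : x ∈ _)) hy
  have hv := Submodule.inner_left_of_mem_orthogonal (Submodule.subset_span (by simp : v ∈ _)) hy
  refine ⟨(‖y‖⁻¹ : ℝ) • y, norm_smul_inv_norm hy0, ?_, ?_⟩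
  · rw [inner_smul_left, hx, mul_zero]
  · rw [inner_smul_left, hv, mul_zero]

/-- The Hessian of `F` in a direction orthogonal to the radial one is at most half the trace. -/
lemma hessian_F_le (x v : E3) (h : inner ℝ v x = 0) :
    ∑ i, ∑ j, v i * v j * pd j (pd i F) x ≤ 2⁻¹ * ‖v‖ ^ 2 * F x := by
  obtain ⟨y, hy1, hyx, hyv⟩ := exists_orthogonal x v
  set z := ‖v‖ • y with hz
  have hzn : ‖v‖ = ‖z‖ := by rw [hz, norm_smul, hy1]; simp
  have hzx : inner ℝ z x = 0 := by rw [hz, inner_smul_left, hyx, mul_zero]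
  -- This reflection swaps v with z, a vector of equal length orthogonal to v and x, and it fixes x
  -- because both are orthogonal to x. Symmetry thus equates the Hessian along v and along z.
  set L := (ℝ ∙ (v - z))ᗮ.reflection with hL
  have hLv : L v = z := Submodule.reflection_sub hzn
  have hLz : L z = v := by rw [← hLv, Submodule.reflection_reflection]
  have hLx : L x = x := by
    apply Submodule.reflection_mem_subspace_eq_self
    rw [Submodule.mem_orthogonal_singleton_iff_inner_right, inner_sub_left, h, hzx, sub_zero]
  have e1 : sphInt (fun ω => inner ℝ ω v ^ 2) x = sphInt (fun ω => inner ℝ ω z ^ 2) x := by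
    unfold sphInt
    rw [← integral_surf_comp L fun ω => inner ℝ ω v ^ 2 * Real.exp (inner ℝ ω x)]
    have : ∀ ω : E3, inner ℝ (L ω) v = inner ℝ ω z ∧ inner ℝ (L ω) x = inner ℝ ω x := fun ω => by
      constructor
      · rw [← hLz, L.inner_map_map]
      · conv_lhs => rw [← hLx, L.inner_map_map]
    simp_rw [fun ω => (this ω).1, fun ω => (this ω).2]
  have hi := fun z : E3 => integrable_sphInt (g := fun ω => inner ℝ ω z ^ 2) (by fun_prop) x
  -- Bessel's inequality for the two orthogonal directions, integrated over the sphere. The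
  -- nonnegative radial part of the trace is discarded.
  have e2 : sphInt (fun ω => inner ℝ ω v ^ 2) x + sphInt (fun ω => inner ℝ ω z ^ 2) x
      ≤ ‖v‖ ^ 2 * F x := by
    unfold sphInt F
    rw [← integral_add (hi v) (hi z), ← integral_const_mul]
    refine integral_mono ((hi v).add (hi z)) (integrable_surf (by fun_prop)) fun ω => ?_
    simp only
    rw [← add_mul]
    refine mul_le_mul_of_nonneg_right ?_ (Real.exp_pos _).le
    by_cases hv0 : v = 0
    · simp [hz, hv0]
    have hvp : 0 < ‖v‖ := norm_pos_iff.2 hv0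
    have hon : Orthonormal ℝ ![(‖v‖⁻¹ : ℝ) • v, y] := by
      rw [orthonormal_vecCons_iff]
      refine ⟨norm_smul_inv_norm hv0, fun i => ?_, ?_⟩
      · fin_cases i
        change inner ℝ ((‖v‖⁻¹ : ℝ) • v) y = 0
        rw [inner_smul_left, real_inner_comm, hyv, mul_zero]
      · rw [orthonormal_vecCons_iff]
        exact ⟨hy1, fun i => i.elim0, ⟨fun i => i.elim0, fun i => i.elim0⟩⟩
    have hb := hon.sum_inner_products_le (x := (ω : E3)) (s := Finset.univ)
    simp only [Fin.sum_univ_two, Matrix.cons_val_zero, Matrix.cons_val_one, norm_of_sphere,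
      inner_smul_left, mul_pow, Real.norm_eq_abs, sq_abs] at hb
    rw [hz, inner_smul_right, real_inner_comm v, real_inner_comm y]
    simp at hb
    have h3 := mul_le_mul_of_nonneg_left hb (sq_nonneg ‖v‖)
    field_simp at h3
    nlinarith
  rw [hessian_F]
  linarith

/-! ### Growth of the integral of F over balls -/

/-- An antiderivative is 8 R (R - s + 1) e^s, whose value at -R may be dropped. The vanishing factor
R - s at the top of the ball is what saves a power of R; the resulting linear growth is what leads
to a logarithm, hence to an exponential lifespan. -/
lemma lintegral_exp_mul_le {R : ℝ} (hR : 0 ≤ R) :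
    ∫⁻ s in Icc (-R) R, ENNReal.ofReal (8 * R * ((R - s) * Real.exp s)) ≤
      ENNReal.ofReal (8 * R * Real.exp R) := by
  have hc : Continuous fun s : ℝ => 8 * R * ((R - s) * Real.exp s) := by fun_prop
  rw [← ofReal_integral_eq_lintegral_ofReal (hc.integrableOn_Icc)]
  · refine ENNReal.ofReal_le_ofReal ?_
    rw [integral_Icc_eq_integral_Ioc, ← intervalIntegral.integral_of_le (by linarith)]
    have hd : ∀ s ∈ uIcc (-R) R, HasDerivAt (fun s => 8 * R * ((R - s + 1) * Real.exp s))
        (8 * R * ((R - s) * Real.exp s)) s := fun s _ => by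
      have h1 : HasDerivAt (fun s => R - s + 1) (-1) s := ((hasDerivAt_id s).const_sub R).add_const 1
      refine ((h1.mul (Real.hasDerivAt_exp s)).const_mul (8 * R)).congr_deriv ?_
      ring
    rw [intervalIntegral.integral_eq_sub_of_hasDerivAt hd (hc.intervalIntegrable _ _)]
    have : 0 ≤ 8 * R * ((R - -R + 1) * Real.exp (-R)) := by
      rw [sub_neg_eq_add]
      positivity
    linarith
  · refine (ae_restrict_mem measurableSet_Icc).mono fun s hs => ?_
    have : 0 ≤ R - s := by linarith [hs.2]
    simp only [Pi.zero_apply]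
    positivity

/-- Integration over slices orthogonal to the last coordinate axis. -/
lemma lintegral_ball_exp_le {R : ℝ} (hR : 0 ≤ R) :
    ∫⁻ x in Metric.closedBall (0 : E3) R, ENNReal.ofReal (Real.exp (x 2)) ≤
      ENNReal.ofReal (8 * R * Real.exp R) := by
  -- Circular slices are enlarged to squares, whose area is an elementary product; only an upper
  -- bound is needed.
  set D : Set (ℝ × (Fin 2 → ℝ)) :=
    {q | q.1 ∈ Icc (-R) R ∧ ∀ i, q.2 i ∈ Icc (-√(R ^ 2 - q.1 ^ 2)) (√(R ^ 2 - q.1 ^ 2))} with hD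
  have hDm : MeasurableSet D := by
    have hc : IsClosed D := by
      have e : D = (Prod.fst ⁻¹' Icc (-R) R) ∩ ⋂ i : Fin 2, ({q : ℝ × (Fin 2 → ℝ) | -√(R ^ 2 - q.1 ^ 2) ≤ q.2 i} ∩
          {q : ℝ × (Fin 2 → ℝ) | q.2 i ≤ √(R ^ 2 - q.1 ^ 2)}) := by
        ext q
        simp [hD]
      rw [e]
      refine (isClosed_Icc.preimage continuous_fst).inter (isClosed_iInter fun i => ?_)
      exact (isClosed_le (by fun_prop) (by fun_prop)).inter (isClosed_le (by fun_prop) (by fun_prop))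
    exact hc.measurableSet
  set h : ℝ × (Fin 2 → ℝ) → ENNReal := D.indicator fun q => ENNReal.ofReal (Real.exp q.1) with hh
  have hhm : Measurable h := Measurable.indicator (by fun_prop) hDm
  have hΦ := (volume_preserving_piFinSuccAbove (fun _ : Fin 3 => ℝ) 2).comp
    (EuclideanSpace.volume_preserving_symm_measurableEquiv_toLp (Fin 3))
  calc ∫⁻ x in Metric.closedBall (0 : E3) R, ENNReal.ofReal (Real.exp (x 2))
      ≤ ∫⁻ x : E3, h ((MeasurableEquiv.piFinSuccAbove (fun _ : Fin 3 => ℝ) 2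
          ∘ (MeasurableEquiv.toLp 2 (Fin 3 → ℝ)).symm) x) := by
        rw [← lintegral_indicator Metric.isClosed_closedBall.measurableSet]
        refine lintegral_mono fun x => ?_
        by_cases hx : x ∈ Metric.closedBall (0 : E3) R
        · rw [indicator_of_mem hx]
          have hx2 : ‖x‖ ^ 2 ≤ R ^ 2 := by
            rw [mem_closedBall_zero_iff] at hx
            gcongr
          rw [← sub_zero x, norm_sub_sq_eq_sum, Fin.sum_univ_three] at hx2
          simp only [PiLp.zero_apply, sub_zero] at hx2
          have hmem : ((x 2, fun i => x (Fin.succAbove 2 i)) : ℝ × (Fin 2 → ℝ)) ∈ D := by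
            refine ⟨abs_le.1 (abs_le_of_sq_le_sq (by nlinarith) hR), fun i => abs_le.1 ?_⟩
            refine Real.abs_le_sqrt ?_
            fin_cases i
            · change x 0 ^ 2 ≤ R ^ 2 - x 2 ^ 2
              nlinarith
            · change x 1 ^ 2 ≤ R ^ 2 - x 2 ^ 2
              nlinarith
          exact (indicator_of_mem hmem fun q => ENNReal.ofReal (Real.exp q.1)).ge
        · rw [indicator_of_notMem hx]
          exact zero_le
    _ = ∫⁻ q, h q := hΦ.lintegral_comp hhm
    _ = ∫⁻ s, ∫⁻ y, h (s, y) := lintegral_prod _ hhm.aemeasurable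
    _ ≤ ∫⁻ s, (Icc (-R) R).indicator
          (fun s => ENNReal.ofReal (8 * R * ((R - s) * Real.exp s))) s := by
        refine lintegral_mono fun s => ?_
        by_cases hs : s ∈ Icc (-R) R
        · rw [indicator_of_mem hs]
          have e : ∀ y, h (s, y) = (Icc (fun _ => -√(R ^ 2 - s ^ 2)) (fun _ => √(R ^ 2 - s ^ 2)) :
              Set (Fin 2 → ℝ)).indicator (fun _ => ENNReal.ofReal (Real.exp s)) y := by
            intro y
            by_cases hy : (s, y) ∈ D
            · rw [hh, indicator_of_mem hy, indicator_of_mem]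
              exact ⟨fun i => (hy.2 i).1, fun i => (hy.2 i).2⟩
            · rw [hh, indicator_of_notMem hy, indicator_of_notMem]
              exact fun hy' => hy ⟨hs, fun i => ⟨hy'.1 i, hy'.2 i⟩⟩
          simp_rw [e]
          rw [lintegral_indicator measurableSet_Icc, setLIntegral_const, Real.volume_Icc_pi]
          simp only [Fin.prod_univ_two]
          rw [← ENNReal.ofReal_mul (by rw [sub_neg_eq_add]; positivity),
            ← ENNReal.ofReal_mul (Real.exp_pos s).le]
          refine ENNReal.ofReal_le_ofReal ?_
          have h1 : 0 ≤ R ^ 2 - s ^ 2 := by nlinarith [hs.1, hs.2]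
          have h2 := Real.mul_self_sqrt h1
          have h3 : 4 * (R ^ 2 - s ^ 2) ≤ 8 * R * (R - s) := by nlinarith [hs.1, hs.2]
          have h4 := mul_le_mul_of_nonneg_left h3 (Real.exp_pos s).le
          calc _ = Real.exp s * (4 * (√(R ^ 2 - s ^ 2) * √(R ^ 2 - s ^ 2))) := by ring
            _ ≤ _ := by rw [h2]; linarith
        · rw [indicator_of_notMem hs]
          refine le_of_eq ?_
          have : ∀ y, h (s, y) = 0 := fun y => indicator_of_notMem (fun hy => hs hy.1) _
          simp [this]
    _ = ∫⁻ s in Icc (-R) R, ENNReal.ofReal (8 * R * ((R - s) * Real.exp s)) :=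
        lintegral_indicator measurableSet_Icc _
    _ ≤ _ := lintegral_exp_mul_le hR

lemma setIntegral_ball_exp_le {R : ℝ} (hR : 0 ≤ R) :
    ∫ x in Metric.closedBall (0 : E3) R, Real.exp (x 2) ≤ 8 * R * Real.exp R := by
  rw [integral_eq_lintegral_of_nonneg_ae (Eventually.of_forall fun x => (Real.exp_pos _).le)
    (Continuous.aestronglyMeasurable (by fun_prop))]
  exact ENNReal.toReal_le_of_le_ofReal (by positivity) (lintegral_ball_exp_le hR)

/-- A reflection exchanging ω with the last basis vector preserves both the ball and the volume. -/
lemma setIntegral_ball_exp_inner (R : ℝ) {ω : E3} (hω : ‖ω‖ = 1) :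
    ∫ x in Metric.closedBall (0 : E3) R, Real.exp (inner ℝ ω x) =
      ∫ x in Metric.closedBall (0 : E3) R, Real.exp (x 2) := by
  set e : E3 := EuclideanSpace.single 2 1 with he
  set L := (ℝ ∙ (e - ω))ᗮ.reflection with hL
  have hLe : L e = ω := Submodule.reflection_sub (by rw [hω, he]; simp)
  have hp : L ⁻¹' Metric.closedBall (0 : E3) R = Metric.closedBall 0 R := by
    ext x
    simp
  have h := L.measurePreserving.setIntegral_preimage_emb
    L.toHomeomorph.measurableEmbedding (fun x => Real.exp (inner ℝ ω x)) (Metric.closedBall 0 R)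
  rw [hp] at h
  rw [← h]
  refine integral_congr_ae (Eventually.of_forall fun x => ?_)
  simp only
  rw [← hLe, L.inner_map_map, he, EuclideanSpace.inner_single_left]
  simp

/-- The growth of the mass of `F` on balls. -/
theorem setIntegral_ball_F_le {R : ℝ} (hR : 0 ≤ R) :
    ∫ x in Metric.closedBall (0 : E3) R, F x ≤ 8 * surf.real univ * (R * Real.exp R) := by
  unfold F
  have hfin : IsFiniteMeasure ((volume : Measure E3).restrict (Metric.closedBall 0 R)) :=
    ⟨by rw [Measure.restrict_apply_univ]; exact (isCompact_closedBall _ _).measure_lt_top⟩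
  rw [integral_integral_swap]
  · simp_rw [fun ω => setIntegral_ball_exp_inner R (norm_of_sphere ω)]
    rw [integral_const, smul_eq_mul]
    have h := mul_le_mul_of_nonneg_left (setIntegral_ball_exp_le hR)
      (measureReal_nonneg (μ := surf) (s := univ))
    linarith
  · have hc : Continuous (Function.uncurry fun (x : E3) (ω : Metric.sphere (0 : E3) 1) =>
        Real.exp (inner ℝ (ω : E3) x)) := by
      unfold Function.uncurry
      fun_prop
    rw [← Measure.restrict_univ (μ := (volume : Measure E3).toSphere), Measure.prod_restrict]
    exact hc.continuousOn.integrableOn_compact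
      ((isCompact_closedBall (0 : E3) R).prod isCompact_univ)

/-! ### Entropy minimum principle, conserved momentum and the stress inequality -/

section Functionals

variable {γ μ : ℝ} {T : EReal} {r p s : ℝ × E3 → ℝ} {w b : Fin 3 → ℝ × E3 → ℝ} {pb : ℝ}

lemma eq_zero_of_integral_slice_nonpos {a : ℝ × E3 → ℝ} (ha : ContinuousOn a (slab T)) {t R : ℝ}
    (h0 : 0 ≤ t) (hT : (t : EReal) < T) (hs : ∀ x, R < ‖x‖ → a (t, x) = 0)
    (hnn : ∀ x, 0 ≤ a (t, x)) (hle : ∫ x, a (t, x) ≤ 0) (x : E3) : a (t, x) = 0 := by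
  have hzero : (fun x => a (t, x)) = fun _ => 0 := by
    refine ((continuous_slice ha h0 hT).ae_eq_iff_eq volume continuous_const).1 ?_
    exact (integral_eq_zero_iff_of_nonneg hnn (integrable_slice ha h0 hT hs)).1
      (le_antisymm hle (integral_nonneg hnn))
  exact congrFun hzero x

/-- The minimum principle for the entropy. -/
theorem le_entropy (h : ScalarSolution γ μ T r w p s b) {sb : ℝ}
    (hout : ∀ q ∈ slab T, 1 + q.1 < ‖q.2‖ → s q = sb) (hinit : ∀ x, sb ≤ s (0, x))
    {q : ℝ × E3} (hq : q ∈ slab T) : sb ≤ s q := by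
  -- The truncated defect is transported by the flow. Multiplied by the density it obeys a
  -- conservation law, so its integral keeps the initial value zero.
  set κ : ℝ × E3 → ℝ := fun q => max 0 (sb - s q) ^ 2 with hκ
  have cκ : ContDiffOn ℝ 1 κ (slab T) :=
    contDiff_max_zero_sq.comp_contDiffOn (contDiffOn_const.sub h.contDiff_s)
  have ca : ContDiffOn ℝ 1 (fun q => r q * κ q) (slab T) := h.contDiff_r.mul cκ
  have cb : ∀ j, ContDiffOn ℝ 1 (fun q => w j q * (r q * κ q)) (slab T) := fun j =>
    (h.contDiff_w j).mul ca
  have hzero : ∀ q ∈ slab T, 1 + q.1 < ‖q.2‖ → r q * κ q = 0 := fun q hq hx => by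
    simp [hκ, hout q hq hx]
  have hsupp : ∀ t₁ : ℝ, (t₁ : EReal) < T → ∃ R : ℝ, ∀ q : ℝ × E3, 0 ≤ q.1 → q.1 ≤ t₁ →
      R < ‖q.2‖ → r q * κ q = 0 ∧ ∀ j, w j q * (r q * κ q) = 0 := fun t₁ ht₁ =>
    ⟨1 + t₁, fun q h0 h1 h2 => by
      have := hzero q (mem_slab_of_le ht₁ h0 h1) (by linarith)
      simp only [this, mul_zero, implies_true, and_self]⟩
  have hbal : ∀ q ∈ slab T, 0 < q.1 → dir tvec (fun q => r q * κ q) q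
      + ∑ j, dir (xvec j) (fun q => w j q * (r q * κ q)) q = 0 := by
    intro q hq h0
    have dr := differentiableAt_of_slab h.contDiff_r h0 hq.2
    have dw := fun i => differentiableAt_of_slab (h.contDiff_w i) h0 hq.2
    have ds := differentiableAt_of_slab h.contDiff_s h0 hq.2
    have dk := differentiableAt_of_slab cκ h0 hq.2
    have e : ∀ v, dir v κ q = -(2 * max 0 (sb - s q)) * dir v s q := fun v => by
      have h1 := dir_comp (φ := fun y => max 0 y ^ 2) (v := v)
        (hasDerivAt_max_zero_sq (sb - s q)) (ds.const_sub sb)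
      have h2 : dir v (fun q => sb - s q) q = -dir v s q := by
        rw [dir, fderiv_const_sub]
        rfl
      rw [hκ, h1, h2]
      ring
    rw [dir_mul dr dk]
    simp_rw [fun j => dir_mul (v := xvec j) (dw j) (dr.fun_mul dk),
      fun j => dir_mul (v := xvec j) dr dk, e]
    rw [h.mass q hq h0, h.entropy q hq h0]
    simp only [Fin.sum_univ_three]
    ring
  obtain ⟨t, x⟩ := q
  have ht0 : 0 ≤ t := hq.1
  have hle : ∫ x, r (t, x) * κ (t, x) ≤ 0 := by
    refine nonpos_of_deriv_le_mul (C := 0) (f := fun t => ∫ x, r (t, x) * κ (t, x)) ht0 ?_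
      (fun τ hτ => (hasDerivAt_integral_balance ca cb hsupp hτ.1
        ((EReal.coe_lt_coe_iff.2 hτ.2).trans hq.2)).2) ?_ ?_
    · refine (continuousOn_integral_slice ca.continuousOn fun t₁ h1 => ?_).mono fun τ hτ =>
        mem_slab_of_le (q := (τ, (0 : E3))) hq.2 hτ.1 hτ.2
      obtain ⟨ρ, hρ⟩ := hsupp t₁ h1
      exact ⟨ρ, fun q a b c => (hρ q a b c).1⟩
    · intro τ hτ
      rw [zero_mul]
      simp_rw [fun x : E3 => hbal (τ, x) (mem_slab_of_le hq.2 hτ.1.le hτ.2.le) hτ.1]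
      simp
    · refine le_of_eq ?_
      refine (integral_congr_ae (Eventually.of_forall fun x => ?_)).trans (integral_zero E3 ℝ)
      simp [hκ, hinit x]
  have hz := eq_zero_of_integral_slice_nonpos ca.continuousOn ht0 hq.2 (R := 1 + t)
    (fun x hx => hzero (t, x) ⟨ht0, hq.2⟩ hx)
    (fun y => mul_nonneg (h.pos (t, y) ⟨ht0, hq.2⟩).le (sq_nonneg _)) hle x
  have hk := (mul_eq_zero.1 hz).resolve_left (h.pos _ hq).ne'
  have hm : max 0 (sb - s (t, x)) = 0 := pow_eq_zero_iff two_ne_zero |>.1 hk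
  linarith [le_max_right 0 (sb - s (t, x))]

/-- The momentum flux tensor, relative to the constant state. -/
def stress (μ pb : ℝ) (r : ℝ × E3 → ℝ) (w : Fin 3 → ℝ × E3 → ℝ) (p : ℝ × E3 → ℝ)
    (b : Fin 3 → ℝ × E3 → ℝ) (i j : Fin 3) (q : ℝ × E3) : ℝ :=
  r q * w i q * w j q - μ⁻¹ * (b i q * b j q)
    + (if i = j then 1 else 0) * (p q - pb + μ⁻¹ * ∑ k, 2⁻¹ * b k q ^ 2)

lemma contDiffOn_stress (h : ScalarSolution γ μ T r w p s b) (i j : Fin 3) :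
    ContDiffOn ℝ 1 (stress μ pb r w p b i j) (slab T) := by
  unfold stress
  have h2 : ContDiffOn ℝ 1 (fun q => ∑ i, 2⁻¹ * b i q ^ 2) (slab T) :=
    ContDiffOn.sum fun i _ => contDiffOn_const.mul ((h.contDiff_b i).pow 2)
  exact (((h.contDiff_r.mul (h.contDiff_w i)).mul (h.contDiff_w j)).sub
    (contDiffOn_const.mul ((h.contDiff_b i).mul (h.contDiff_b j)))).add
    (contDiffOn_const.mul ((h.contDiff_p.sub contDiffOn_const).add (contDiffOn_const.mul h2)))

/-- The momentum equation in conservation form. -/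
lemma momentum_conservation (h : ScalarSolution γ μ T r w p s b) {q : ℝ × E3}
    (hq : q ∈ slab T) (h0 : 0 < q.1) (i : Fin 3) :
    dir tvec (fun q => r q * w i q) q + ∑ j, dir (xvec j) (stress μ pb r w p b i j) q = 0 := by
  have dr := differentiableAt_of_slab h.contDiff_r h0 hq.2
  have dw := fun i => differentiableAt_of_slab (h.contDiff_w i) h0 hq.2
  have dp := differentiableAt_of_slab h.contDiff_p h0 hq.2
  have db := fun i => differentiableAt_of_slab (h.contDiff_b i) h0 hq.2
  have dbb : ∀ k, DifferentiableAt ℝ (fun q => 2⁻¹ * b k q ^ 2) q := fun k =>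
    ((db k).fun_pow 2).const_mul _
  have dB : DifferentiableAt ℝ (fun q => ∑ k, 2⁻¹ * b k q ^ 2) q :=
    DifferentiableAt.fun_sum fun k _ => dbb k
  have e : ∀ j v, dir v (stress μ pb r w p b i j) q =
      (dir v r q * w i q + r q * dir v (w i) q) * w j q + r q * w i q * dir v (w j) q
      - μ⁻¹ * (dir v (b i) q * b j q + b i q * dir v (b j) q)
      + (if i = j then 1 else 0) * (dir v p q + μ⁻¹ * ∑ k, b k q * dir v (b k) q) := by
    intro j v
    have d1 := (dr.fun_mul (dw i)).fun_mul (dw j)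
    have d2 := ((db i).fun_mul (db j)).const_mul μ⁻¹
    have d3 := (dp.sub_const pb).fun_add (dB.const_mul μ⁻¹)
    unfold stress
    rw [dir_add (d1.fun_sub d2) (d3.const_mul _), dir_sub d1 d2,
      dir_mul (dr.fun_mul (dw i)) (dw j), dir_mul dr (dw i),
      dir_const_mul _ ((db i).fun_mul (db j)), dir_mul (db i) (db j), dir_const_mul _ d3,
      dir_add (dp.sub_const pb) (dB.const_mul μ⁻¹), dir_sub_const, dir_const_mul _ dB,
      dir_sum _ fun k _ => dbb k]
    congr 4
    refine Finset.sum_congr rfl fun k _ => ?_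
    rw [dir_const_mul _ ((db k).fun_pow 2), dir_sq (db k)]
    ring
  rw [dir_mul dr (dw i)]
  simp_rw [e]
  have h1 := h.mass q hq h0
  have h2 := h.momentum q hq h0 i
  have h3 := h.divergence_free q hq h0
  simp only [Fin.sum_univ_three] at h1 h2 h3 ⊢
  -- The mass equation collects the derivatives of the density; div B = 0 turns the Lorentz force
  -- into a divergence.
  fin_cases i <;> simp at h2 ⊢
  · linear_combination w 0 q * h1 + h2 - μ⁻¹ * b 0 q * h3
  · linear_combination w 1 q * h1 + h2 - μ⁻¹ * b 1 q * h3
  · linear_combination w 2 q * h1 + h2 - μ⁻¹ * b 2 q * h3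

/-- The density is transported: first moment identity for `F`. -/
lemma moment_balance (h : ScalarSolution γ μ T r w p s b) {q : ℝ × E3}
    (hq : q ∈ slab T) (h0 : 0 < q.1) :
    dir tvec (fun q => (r q - 1) * F q.2) q
      + ∑ j, dir (xvec j) (fun q => r q * w j q * F q.2) q =
    ∑ i, r q * w i q * pd i F q.2 := by
  have dr := differentiableAt_of_slab h.contDiff_r h0 hq.2
  have dw := fun i => differentiableAt_of_slab (h.contDiff_w i) h0 hq.2
  have dF : DifferentiableAt ℝ F q.2 := contDiff_F.differentiable (by norm_num) _
  have dF' : DifferentiableAt ℝ (fun q : ℝ × E3 => F q.2) q := dF.comp q differentiableAt_snd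
  rw [dir_mul (dr.sub_const 1) dF', dir_sub_const, dir_tvec_space dF]
  simp_rw [fun j => dir_mul (v := xvec j) (dr.fun_mul (dw j)) dF',
    fun j => dir_mul (v := xvec j) dr (dw j), fun j => dir_xvec_space dF j]
  rw [h.mass q hq h0]
  simp only [Fin.sum_univ_three]
  ring

/-- Integration by parts in pointwise form: the flux divergence stays on the left, where
`hasDerivAt_integral_balance` accounts for its vanishing integral. -/
lemma momentum_moment_balance (h : ScalarSolution γ μ T r w p s b) {q : ℝ × E3}
    (hq : q ∈ slab T) (h0 : 0 < q.1) :
    dir tvec (fun q => ∑ i, r q * w i q * pd i F q.2) q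
      + ∑ j, dir (xvec j) (fun q => ∑ i, stress μ pb r w p b i j q * pd i F q.2) q =
    ∑ i, ∑ j, stress μ pb r w p b i j q * pd j (pd i F) q.2 := by
  have dr := differentiableAt_of_slab h.contDiff_r h0 hq.2
  have dw := fun i => differentiableAt_of_slab (h.contDiff_w i) h0 hq.2
  have dm := fun i j => differentiableAt_of_slab (contDiffOn_stress (pb := pb) h i j) h0 hq.2
  have dF : ∀ i, DifferentiableAt ℝ (pd i F) q.2 := fun i =>
    (contDiff_pd_F i).differentiable (by norm_num) _
  have dF' : ∀ i, DifferentiableAt ℝ (fun q : ℝ × E3 => pd i F q.2) q := fun i =>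
    (dF i).comp q differentiableAt_snd
  rw [dir_sum _ fun i _ => (dr.fun_mul (dw i)).fun_mul (dF' i)]
  simp_rw [fun i => dir_mul (v := tvec) (dr.fun_mul (dw i)) (dF' i), fun i => dir_tvec_space (dF i),
    fun j => dir_sum (v := xvec j) Finset.univ fun i _ => (dm i j).fun_mul (dF' i),
    fun i j => dir_mul (v := xvec j) (dm i j) (dF' i), fun i j => dir_xvec_space (dF i) j]
  have e := fun i => momentum_conservation (pb := pb) h hq h0 i
  have e0 := e 0
  have e1 := e 1
  have e2 := e 2
  simp only [Fin.sum_univ_three] at e0 e1 e2 ⊢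
  linear_combination pd 0 F q.2 * e0 + pd 1 F q.2 * e1 + pd 2 F q.2 * e2

/-- The magnetic stress helps when the field is orthogonal to the radial direction. -/
lemma pressure_le_stress (hμ : 0 < μ) {q : ℝ × E3} (hr : 0 < r q) (hb : ∑ i, b i q * q.2 i = 0) :
    (p q - pb) * F q.2 ≤ ∑ i, ∑ j, stress μ pb r w p b i j q * pd j (pd i F) q.2 := by
  have h1 := hessian_F_nonneg q.2 (WithLp.toLp 2 fun i => w i q)
  have h2 := hessian_F_le q.2 (WithLp.toLp 2 fun i => b i q) (by rw [inner_eq_sum]; exact hb)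
  have h3 := laplacian_F q.2
  have h4 : ‖(WithLp.toLp 2 fun i => b i q : E3)‖ ^ 2 = ∑ i, b i q ^ 2 := by
    rw [EuclideanSpace.norm_sq_eq]
    simp
  rw [h4] at h2
  -- Kinetic, magnetic and pressure parts. The first two are nonnegative, the second because half
  -- the trace dominates the Hessian along the field.
  have e : ∑ i, ∑ j, stress μ pb r w p b i j q * pd j (pd i F) q.2 =
      r q * (∑ i, ∑ j, w i q * w j q * pd j (pd i F) q.2)
      + μ⁻¹ * (2⁻¹ * (∑ i, b i q ^ 2) * (∑ i, pd i (pd i F) q.2)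
        - ∑ i, ∑ j, b i q * b j q * pd j (pd i F) q.2)
      + (p q - pb) * ∑ i, pd i (pd i F) q.2 := by
    simp [stress, Fin.sum_univ_three]
    ring
  rw [e, h3]
  have h5 := mul_nonneg hr.le h1
  have h6 := mul_nonneg (inv_pos.2 hμ).le (sub_nonneg.2 h2)
  simp only at h5 h6
  linarith

end Functionals

/-! ### The two moments and their evolution -/

section Moments

variable {γ μ : ℝ} {T : EReal} {r p s : ℝ × E3 → ℝ} {w b : Fin 3 → ℝ × E3 → ℝ} {pb : ℝ}

/-- The perturbation of the constant state is confined to the ball of radius `1 + t`. -/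
def Confined (T : EReal) (pb : ℝ) (r : ℝ × E3 → ℝ) (w : Fin 3 → ℝ × E3 → ℝ) (p : ℝ × E3 → ℝ)
    (b : Fin 3 → ℝ × E3 → ℝ) : Prop :=
  ∀ q ∈ slab T, 1 + q.1 < ‖q.2‖ →
    p q = pb ∧ (∀ i, w i q = 0) ∧ (∀ i, b i q = 0) ∧ r q = 1

/-- The moment of the density against `F`. -/
def massMoment (r : ℝ × E3 → ℝ) (t : ℝ) : ℝ := ∫ x, (r (t, x) - 1) * F x

/-- The moment of the momentum against the gradient of `F`. -/
def momentumMoment (r : ℝ × E3 → ℝ) (w : Fin 3 → ℝ × E3 → ℝ) (t : ℝ) : ℝ :=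
  ∫ x, ∑ i, r (t, x) * w i (t, x) * pd i F x

lemma contDiffOn_comp_snd {g : E3 → ℝ} (hg : ContDiff ℝ 1 g) (D : Set (ℝ × E3)) :
    ContDiffOn ℝ 1 (fun q : ℝ × E3 => g q.2) D :=
  (hg.comp contDiff_snd).contDiffOn

lemma contDiffOn_massDensity (h : ScalarSolution γ μ T r w p s b) :
    ContDiffOn ℝ 1 (fun q : ℝ × E3 => (r q - 1) * F q.2) (slab T) :=
  (h.contDiff_r.sub contDiffOn_const).mul (contDiffOn_comp_snd contDiff_F _)

lemma contDiffOn_massFlux (h : ScalarSolution γ μ T r w p s b) (j : Fin 3) :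
    ContDiffOn ℝ 1 (fun q : ℝ × E3 => r q * w j q * F q.2) (slab T) :=
  (h.contDiff_r.mul (h.contDiff_w j)).mul (contDiffOn_comp_snd contDiff_F _)

lemma contDiffOn_momentumDensity (h : ScalarSolution γ μ T r w p s b) :
    ContDiffOn ℝ 1 (fun q : ℝ × E3 => ∑ i, r q * w i q * pd i F q.2) (slab T) :=
  ContDiffOn.sum fun i _ => (h.contDiff_r.mul (h.contDiff_w i)).mul
    (contDiffOn_comp_snd (contDiff_pd_F i) _)

lemma contDiffOn_momentumFlux (h : ScalarSolution γ μ T r w p s b) (j : Fin 3) :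
    ContDiffOn ℝ 1 (fun q : ℝ × E3 => ∑ i, stress μ pb r w p b i j q * pd i F q.2) (slab T) :=
  ContDiffOn.sum fun i _ => (contDiffOn_stress h i j).mul
    (contDiffOn_comp_snd (contDiff_pd_F i) _)

lemma supp_mass (hc : Confined T pb r w p b) : ∀ t₁ : ℝ, (t₁ : EReal) < T → ∃ R : ℝ,
    ∀ q : ℝ × E3, 0 ≤ q.1 → q.1 ≤ t₁ → R < ‖q.2‖ →
      (r q - 1) * F q.2 = 0 ∧ ∀ j, r q * w j q * F q.2 = 0 := fun t₁ ht₁ =>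
  ⟨1 + t₁, fun q h0 h1 h2 => by
    obtain ⟨-, e2, -, e4⟩ := hc q (mem_slab_of_le ht₁ h0 h1) (by linarith)
    simp [e2, e4]⟩

lemma supp_momentum (hc : Confined T pb r w p b) : ∀ t₁ : ℝ, (t₁ : EReal) < T → ∃ R : ℝ,
    ∀ q : ℝ × E3, 0 ≤ q.1 → q.1 ≤ t₁ → R < ‖q.2‖ →
      ∑ i, r q * w i q * pd i F q.2 = 0 ∧
        ∀ j, ∑ i, stress μ pb r w p b i j q * pd i F q.2 = 0 := fun t₁ ht₁ =>
  ⟨1 + t₁, fun q h0 h1 h2 => by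
    obtain ⟨e1, e2, e3, e4⟩ := hc q (mem_slab_of_le ht₁ h0 h1) (by linarith)
    simp [stress, e1, e2, e3]⟩

lemma continuousOn_massMoment (h : ScalarSolution γ μ T r w p s b) (hc : Confined T pb r w p b) :
    ContinuousOn (massMoment r) {t : ℝ | 0 ≤ t ∧ (t : EReal) < T} := by
  refine continuousOn_integral_slice (contDiffOn_massDensity h).continuousOn fun t₁ h1 => ?_
  obtain ⟨R, hR⟩ := supp_mass hc t₁ h1
  exact ⟨R, fun q a b c => (hR q a b c).1⟩

lemma continuousOn_momentumMoment (h : ScalarSolution γ μ T r w p s b)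
    (hc : Confined T pb r w p b) :
    ContinuousOn (momentumMoment r w) {t : ℝ | 0 ≤ t ∧ (t : EReal) < T} := by
  refine continuousOn_integral_slice (contDiffOn_momentumDensity h).continuousOn fun t₁ h1 => ?_
  obtain ⟨R, hR⟩ := supp_momentum (μ := μ) hc t₁ h1
  exact ⟨R, fun q a b c => (hR q a b c).1⟩

lemma hasDerivAt_massMoment (h : ScalarSolution γ μ T r w p s b) (hc : Confined T pb r w p b)
    {t : ℝ} (h0 : 0 < t) (hT : (t : EReal) < T) :
    HasDerivAt (massMoment r) (momentumMoment r w t) t := by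
  have e := (hasDerivAt_integral_balance (contDiffOn_massDensity h) (contDiffOn_massFlux h)
    (supp_mass hc) h0 hT).2
  simp_rw [fun x : E3 => moment_balance h (q := (t, x)) ⟨h0.le, hT⟩ h0] at e
  exact e

lemma integrable_pressure (h : ScalarSolution γ μ T r w p s b) (hc : Confined T pb r w p b)
    {t : ℝ} (h0 : 0 ≤ t) (hT : (t : EReal) < T) :
    Integrable fun x => (p (t, x) - pb) * F x :=
  integrable_slice (f := fun q => (p q - pb) * F q.2) (R := 1 + t)
    ((h.contDiff_p.continuousOn.sub continuousOn_const).mul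
      (contDiffOn_comp_snd contDiff_F _).continuousOn) h0 hT fun x hx => by
    simp [(hc (t, x) ⟨h0, hT⟩ hx).1]

lemma hasDerivAt_momentumMoment (h : ScalarSolution γ μ T r w p s b)
    (hc : Confined T pb r w p b) (hμ : 0 < μ)
    (hperp : ∀ q ∈ slab T, ∑ i, b i q * q.2 i = 0) {t : ℝ} (h0 : 0 < t) (hT : (t : EReal) < T) :
    ∃ Y' : ℝ, HasDerivAt (momentumMoment r w) Y' t ∧ ∫ x, (p (t, x) - pb) * F x ≤ Y' := by
  have e := hasDerivAt_integral_balance (contDiffOn_momentumDensity h)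
    (contDiffOn_momentumFlux (pb := pb) h) (supp_momentum hc) h0 hT
  refine ⟨_, e.2, integral_mono (integrable_pressure h hc h0.le hT) e.1 fun x => ?_⟩
  have hq : (t, x) ∈ slab T := ⟨h0.le, hT⟩
  simp only
  rw [momentum_moment_balance h hq h0]
  exact pressure_le_stress hμ (h.pos _ hq) (hperp _ hq)

/-- The tangent line inequality for `y ^ γ`. -/
lemma tangent_le_rpow (hγ : 1 < γ) {a y : ℝ} (ha : 0 < a) (hy : 0 ≤ y) :
    a ^ γ + γ * a ^ (γ - 1) * (y - a) ≤ y ^ γ := by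
  have h := one_add_mul_self_le_rpow_one_add (s := y / a - 1) (p := γ)
    (by linarith [div_nonneg hy ha.le]) hγ.le
  rw [add_sub_cancel, Real.div_rpow hy ha.le] at h
  have hap : 0 < a ^ γ := Real.rpow_pos_of_pos ha γ
  have h2 := mul_le_mul_of_nonneg_left h hap.le
  rw [mul_div_cancel₀ _ hap.ne'] at h2
  refine le_trans (le_of_eq ?_) h2
  rw [Real.rpow_sub_one ha.ne']
  field_simp

/-- Jensen's inequality for the pressure. -/
lemma le_integral_pressure (h : ScalarSolution γ μ T r w p s b) (hc : Confined T pb r w p b)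
    (hγ : 1 < γ) (hpb : γ * pb = 1) (hpr : ∀ q ∈ slab T, pb * r q ^ γ ≤ p q) {t : ℝ} (h0 : 0 ≤ t)
    (hT : (t : EReal) < T) {a W : ℝ} (ha : 0 < a)
    (hW : ∫ x in Metric.closedBall (0 : E3) (1 + t), F x ≤ W) :
    pb * (a ^ γ - 1 - γ * a ^ (γ - 1) * (a - 1)) * W + a ^ (γ - 1) * massMoment r t ≤
      ∫ x, (p (t, x) - pb) * F x := by
  have hpb0 : 0 < pb := by
    by_contra hneg
    nlinarith
  set c := pb * (a ^ γ - 1 - γ * a ^ (γ - 1) * (a - 1)) with hcdef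
  -- The sign lets an upper bound W replace the exact F-mass of the ball. Jensen enters as the
  -- tangent line at a free point a, so no normalised average has to be formed.
  have hc0 : c ≤ 0 := by
    have := tangent_le_rpow hγ ha zero_le_one
    rw [Real.one_rpow] at this
    refine mul_nonpos_of_nonneg_of_nonpos hpb0.le ?_
    linarith
  have hB := (Metric.isClosed_closedBall (x := (0 : E3)) (ε := 1 + t)).measurableSet
  have hFi : IntegrableOn F (Metric.closedBall (0 : E3) (1 + t)) :=
    contDiff_F.continuous.continuousOn.integrableOn_compact (isCompact_closedBall _ _)
  have hi1 : Integrable ((Metric.closedBall (0 : E3) (1 + t)).indicator fun x => c * F x) :=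
    (integrable_indicator_iff hB).2 (hFi.const_mul c)
  have hi2 : Integrable fun x => (r (t, x) - 1) * F x :=
    integrable_slice (f := fun q => (r q - 1) * F q.2) (R := 1 + t)
      (contDiffOn_massDensity h).continuousOn h0 hT fun x hx => by
        simp [(hc (t, x) ⟨h0, hT⟩ hx).2.2.2]
  have key : ∫ x, ((Metric.closedBall (0 : E3) (1 + t)).indicator (fun x => c * F x) x
      + a ^ (γ - 1) * ((r (t, x) - 1) * F x)) ≤ ∫ x, (p (t, x) - pb) * F x := by
    refine integral_mono (hi1.add (hi2.const_mul _)) (integrable_pressure h hc h0 hT) fun x => ?_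
    have hq : (t, x) ∈ slab T := ⟨h0, hT⟩
    simp only
    by_cases hx : x ∈ Metric.closedBall (0 : E3) (1 + t)
    · rw [indicator_of_mem hx, ← mul_assoc, ← add_mul]
      refine mul_le_mul_of_nonneg_right ?_ (F_pos x).le
      have h1 := mul_le_mul_of_nonneg_left (tangent_le_rpow hγ ha (h.pos _ hq).le) hpb0.le
      have h2 := hpr _ hq
      have h3 : a ^ (γ - 1) = γ * pb * a ^ (γ - 1) := by rw [hpb, one_mul]
      calc c + a ^ (γ - 1) * (r (t, x) - 1)
          = c + γ * pb * a ^ (γ - 1) * (r (t, x) - 1) := by rw [← h3]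
        _ = pb * (a ^ γ + γ * a ^ (γ - 1) * (r (t, x) - a)) - pb := by rw [hcdef]; ring
        _ ≤ p (t, x) - pb := by linarith
    · rw [indicator_of_notMem hx]
      rw [mem_closedBall_zero_iff, not_le] at hx
      obtain ⟨e1, -, -, e4⟩ := hc (t, x) hq hx
      simp [e1, e4]
  rw [integral_add hi1 (hi2.const_mul _), integral_indicator hB, integral_const_mul,
    integral_const_mul] at key
  have := mul_le_mul_of_nonpos_left hW hc0
  unfold massMoment
  linarith

end Moments

/-- An azimuthal field is orthogonal to the position vector, also on the axis. -/
lemma inner_eq_zero_of_axisymmetric {T : EReal} {ρ : ℝ → E3 → ℝ} {u : ℝ → E3 → E3}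
    {S : ℝ → E3 → ℝ} {B : ℝ → E3 → E3} (hB : ContDiffOn ℝ 1 (fun q : ℝ × E3 => B q.1 q.2) (slab T))
    (hax : IsAxisymmetric T ρ u S B) {q : ℝ × E3} (hq : q ∈ slab T) :
    ∑ i, B q.1 q.2 i * q.2 i = 0 := by
  obtain ⟨t, x⟩ := q
  obtain ⟨_, _, _, _, Bθ, h⟩ := hax
  have hoff : ∀ y : E3, cylR y ≠ 0 → ∑ i, B t y i * y i = 0 := by
    intro y hy
    rw [(h t y hq.1 hq.2 hy).2.2.2]
    simp [eTheta, Fin.sum_univ_three]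
    ring
  by_cases hx : cylR x ≠ 0
  · exact hoff x hx
  · have hx0 : x 0 = 0 ∧ x 1 = 0 := by
      rw [not_not, cylR, Real.sqrt_eq_zero (by positivity)] at hx
      exact ⟨by nlinarith [sq_nonneg (x 0), sq_nonneg (x 1)],
        by nlinarith [sq_nonneg (x 0), sq_nonneg (x 1)]⟩
    have hcB : Continuous (fun y => B t y) :=
      hB.continuousOn.comp_continuous (f := fun y : E3 => ((t, y) : ℝ × E3)) (by fun_prop)
        (fun _ => hq)
    have hcg : Continuous (fun y : E3 => ∑ i, B t y i * y i) := by fun_prop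
    -- On the axis the angular frame is undefined; the identity is carried there by continuity along
    -- a horizontal line.
    have hline : Continuous (fun δ : ℝ => x + δ • (EuclideanSpace.single 0 1 : E3)) := by fun_prop
    have hlim : Tendsto (fun δ : ℝ => (fun y : E3 => ∑ i, B t y i * y i)
        (x + δ • (EuclideanSpace.single 0 1 : E3))) (𝓝[≠] 0) (𝓝 (∑ i, B t x i * x i)) := by
      have := ((hcg.comp hline).tendsto 0).mono_left (nhdsWithin_le_nhds (s := {0}ᶜ))
      simpa only [Function.comp_def, zero_smul, add_zero] using this
    have hconst : Tendsto (fun δ : ℝ => (fun y : E3 => ∑ i, B t y i * y i)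
        (x + δ • (EuclideanSpace.single 0 1 : E3))) (𝓝[≠] 0) (𝓝 0) := by
      refine tendsto_const_nhds.congr' ?_
      filter_upwards [self_mem_nhdsWithin] with δ hδ
      refine (hoff _ ?_).symm
      rw [cylR]
      simp only [PiLp.add_apply, PiLp.smul_apply, hx0]
      simpa [Real.sqrt_sq_eq_abs] using hδ
    exact tendsto_nhds_unique hlim hconst

/-! ### Lower bounds for the excess -/

/-- The excess of the pressure over its linearisation at the constant state. -/
def excess (γ : ℝ) (s : ℝ) : ℝ := γ⁻¹ * ((1 + s) ^ γ - 1) - s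

section Excess

variable {γ : ℝ}

/-- The tangent to γ⁻¹ (1 + s) ^ γ at s ≥ 0 has slope at least one, which pays for the subtracted
linear term. -/
lemma excess_mono (hγ : 1 < γ) {s s' : ℝ} (hs : 0 ≤ s) (h : s ≤ s') : excess γ s ≤ excess γ s' := by
  have h1 := tangent_le_rpow hγ (a := 1 + s) (y := 1 + s') (by linarith) (by linarith)
  have h2 : 1 ≤ (1 + s) ^ (γ - 1) := Real.one_le_rpow (by linarith) (by linarith)
  have h3 := mul_le_mul_of_nonneg_left h1 (inv_nonneg.2 (zero_le_one.trans hγ.le))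
  have h4 : γ⁻¹ * ((1 + s) ^ γ + γ * (1 + s) ^ (γ - 1) * (1 + s' - (1 + s))) =
      γ⁻¹ * (1 + s) ^ γ + (1 + s) ^ (γ - 1) * (s' - s) := by
    have : γ ≠ 0 := by linarith
    field_simp
    ring
  rw [h4] at h3
  have h5 := mul_le_mul_of_nonneg_right h2 (sub_nonneg.2 h)
  unfold excess
  linarith

/-- Two tangent inequalities are added, from 1 to the midpoint 1 + s/2 and from there to 1 + s. The
increase of slope at the midpoint is the gain; no second derivative is needed. -/
lemma le_excess (hγ : 1 < γ) {s : ℝ} (hs : 0 ≤ s) :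
    s / 2 * ((1 + s / 2) ^ (γ - 1) - 1) ≤ excess γ s := by
  have h1 := tangent_le_rpow hγ (a := 1 + s / 2) (y := 1 + s) (by linarith) (by linarith)
  have h2 := tangent_le_rpow hγ (a := 1) (y := 1 + s / 2) (by linarith) (by linarith)
  rw [Real.one_rpow, Real.one_rpow] at h2
  have h3 := mul_le_mul_of_nonneg_left (add_le_add h1 h2) (inv_nonneg.2 (zero_le_one.trans hγ.le))
  have hne : γ ≠ 0 := by linarith
  have h4 : γ⁻¹ * ((1 + s / 2) ^ γ + γ * (1 + s / 2) ^ (γ - 1) * (1 + s - (1 + s / 2))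
      + (1 + γ * 1 * (1 + s / 2 - 1))) =
      γ⁻¹ * (1 + s / 2) ^ γ + γ⁻¹ + s / 2 * ((1 + s / 2) ^ (γ - 1) + 1) := by
    field_simp
    ring
  rw [h4] at h3
  unfold excess
  linarith

/-- The slope gain in `le_excess` is at least linear in s, by exp x ≥ 1 + x and log x ≥ 1 - 1/x; the
bound s ≤ Λ keeps its coefficient away from zero. -/
lemma mul_sq_le_excess (hγ : 1 < γ) {s Λ : ℝ} (hs : 0 ≤ s) (hsΛ : s ≤ Λ) :
    (γ - 1) / (4 * (1 + Λ / 2)) * s ^ 2 ≤ excess γ s := by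
  refine le_trans ?_ (le_excess hγ hs)
  have hp : 0 < 1 + s / 2 := by linarith
  have hΛ : 0 < 1 + Λ / 2 := by linarith
  have h1 : 1 + (γ - 1) * (1 - (1 + s / 2)⁻¹) ≤ (1 + s / 2) ^ (γ - 1) := by
    rw [Real.rpow_def_of_pos hp]
    have h2 := Real.one_sub_inv_le_log_of_pos hp
    have h3 := Real.add_one_le_exp (Real.log (1 + s / 2) * (γ - 1))
    nlinarith
  have h4 : s / 2 / (1 + Λ / 2) ≤ 1 - (1 + s / 2)⁻¹ := by
    have : 1 - (1 + s / 2)⁻¹ = s / 2 / (1 + s / 2) := by field_simp; ring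
    rw [this]
    gcongr
  have h5 : (γ - 1) * (s / 2 / (1 + Λ / 2)) ≤ (1 + s / 2) ^ (γ - 1) - 1 := by
    have := mul_le_mul_of_nonneg_left h4 (sub_nonneg.2 hγ.le)
    linarith
  refine le_trans (le_of_eq ?_) (mul_le_mul_of_nonneg_left h5 (by linarith : 0 ≤ s / 2))
  field_simp
  ring

/-- For s ≥ 1 the base 1 + s/2 is at least 3/2, so subtracting 1 from its power costs only a fixed
fraction of it. -/
lemma exists_mul_rpow_le_excess (hγ : 1 < γ) :
    ∃ c : ℝ, 0 < c ∧ ∀ s : ℝ, 1 ≤ s → c * s ^ γ ≤ excess γ s := by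
  have h0 : (3 / 2 : ℝ) ^ (γ - 1) > 1 := Real.one_lt_rpow (by norm_num) (by linarith)
  refine ⟨(1 - ((3 / 2 : ℝ) ^ (γ - 1))⁻¹) * (2 ^ γ)⁻¹,
    mul_pos (sub_pos.2 (inv_lt_one_of_one_lt₀ h0)) (by positivity), fun s hs => ?_⟩
  refine le_trans ?_ (le_excess hγ (by linarith))
  have hh : 0 < s / 2 := by linarith
  have h1 : (3 / 2 : ℝ) ^ (γ - 1) ≤ (1 + s / 2) ^ (γ - 1) :=
    Real.rpow_le_rpow (by norm_num) (by linarith) (by linarith)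
  have h2 : (s / 2) ^ (γ - 1) ≤ (1 + s / 2) ^ (γ - 1) :=
    Real.rpow_le_rpow hh.le (by linarith) (by linarith)
  have h3 : (1 - ((3 / 2 : ℝ) ^ (γ - 1))⁻¹) * (s / 2) ^ (γ - 1) ≤ (1 + s / 2) ^ (γ - 1) - 1 := by
    have h4 : (1 - ((3 / 2 : ℝ) ^ (γ - 1))⁻¹) * (s / 2) ^ (γ - 1)
        ≤ (1 - ((3 / 2 : ℝ) ^ (γ - 1))⁻¹) * (1 + s / 2) ^ (γ - 1) :=
      mul_le_mul_of_nonneg_left h2 (sub_pos.2 (inv_lt_one_of_one_lt₀ h0)).le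
    have h5 : 1 ≤ ((3 / 2 : ℝ) ^ (γ - 1))⁻¹ * (1 + s / 2) ^ (γ - 1) := by
      rw [inv_mul_eq_div, one_le_div (by linarith)]
      exact h1
    linarith
  have h6 := mul_le_mul_of_nonneg_left h3 hh.le
  refine le_trans (le_of_eq ?_) h6
  have h7 : (s / 2) ^ γ = s ^ γ * (2 ^ γ)⁻¹ := by
    rw [Real.div_rpow (by linarith) (by norm_num), div_eq_mul_inv]
  have h8 : (s / 2) ^ γ = s / 2 * (s / 2) ^ (γ - 1) := by
    rw [Real.rpow_sub_one hh.ne']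
    field_simp
  rw [mul_assoc, mul_comm (2 ^ γ : ℝ)⁻¹, ← h7, h8]
  ring

end Excess

/-! ### Blow-up for the system of differential inequalities -/

/-- A comparison principle for the second order operator `z'' + 2 z'`, in system form. -/
lemma comparison {d D D' : ℝ → ℝ} {a e : ℝ}
    (hcd : ContinuousOn d (Icc a e)) (hcD : ContinuousOn D (Icc a e))
    (hd : ∀ t ∈ Ioo a e, HasDerivAt d (D t - 2 * d t) t)
    (hD : ∀ t ∈ Ioo a e, HasDerivAt D (D' t) t)
    (hD' : ∀ t ∈ Ioo a e, 0 ≤ d t → 0 ≤ D' t) (hda : 0 < d a) (hDa : 0 ≤ D a) :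
    ∀ t ∈ Icc a e, 0 < d t ∧ 0 ≤ D t := by
  have step : ∀ τ ∈ Icc a e, (∀ t ∈ Ico a τ, 0 < d t) → 0 < d τ ∧ 0 ≤ D τ := by
    intro τ hτ hpos
    have hsub : Icc a τ ⊆ Icc a e := Icc_subset_Icc_right hτ.2
    have hsub' : Ioo a τ ⊆ Ioo a e := Ioo_subset_Ioo_right hτ.2
    have hmono : MonotoneOn D (Icc a τ) := by
      refine monotoneOn_of_deriv_nonneg (convex_Icc a τ) (hcD.mono hsub) ?_ ?_ <;>
        rw [interior_Icc]
      · exact fun t ht => (hD t (hsub' ht)).differentiableAt.differentiableWithinAt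
      · intro t ht
        rw [(hD t (hsub' ht)).deriv]
        exact hD' t (hsub' ht) (hpos t ⟨ht.1.le, ht.2⟩).le
    have hDnn : ∀ t ∈ Icc a τ, 0 ≤ D t := fun t ht =>
      hDa.trans (hmono (left_mem_Icc.2 (ht.1.trans ht.2)) ht ht.1)
    have hder : ∀ t ∈ Ioo a τ, HasDerivAt (fun t => Real.exp (2 * t) * d t)
        (Real.exp (2 * t) * D t) t := fun t ht =>
      ((((hasDerivAt_id t).const_mul 2).exp).mul (hd t (hsub' ht))).congr_deriv (by simp; ring)
    have hmono2 : MonotoneOn (fun t => Real.exp (2 * t) * d t) (Icc a τ) := by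
      refine monotoneOn_of_deriv_nonneg (convex_Icc a τ)
        ((Continuous.continuousOn (by fun_prop)).mul (hcd.mono hsub)) ?_ ?_ <;> rw [interior_Icc]
      · exact fun t ht => (hder t ht).differentiableAt.differentiableWithinAt
      · intro t ht
        rw [(hder t ht).deriv]
        exact mul_nonneg (Real.exp_pos _).le (hDnn t ⟨ht.1.le, ht.2.le⟩)
    have h1 := hmono2 (left_mem_Icc.2 hτ.1) (right_mem_Icc.2 hτ.1) hτ.1
    refine ⟨?_, hDnn τ (right_mem_Icc.2 hτ.1)⟩
    have h2 : 0 < Real.exp (2 * τ) * d τ := lt_of_lt_of_le (mul_pos (Real.exp_pos _) hda) h1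
    exact (mul_pos_iff_of_pos_left (Real.exp_pos _)).1 h2
  -- At a first zero of d, `step` applies on the interval before it: D is nondecreasing there, hence
  -- so is e^{2t} d, which contradicts the zero.
  have hall : ∀ t ∈ Icc a e, 0 < d t := by
    by_contra! hne
    obtain ⟨t₁, ht₁, hdt₁⟩ := hne
    have hK : IsCompact (Icc a e ∩ d ⁻¹' Iic 0) :=
      isCompact_Icc.of_isClosed_subset (hcd.preimage_isClosed_of_isClosed isClosed_Icc isClosed_Iic)
        inter_subset_left
    obtain ⟨τ, ⟨hτ, hτ0⟩, hleast⟩ := hK.exists_isLeast ⟨t₁, ht₁, hdt₁⟩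
    have := (step τ hτ fun t ht => by
      by_contra! hle
      exact absurd (hleast ⟨⟨ht.1, ht.2.le.trans hτ.2⟩, hle⟩) (not_le.2 ht.2)).1
    exact absurd hτ0 (not_le.2 this)
  exact fun t ht => step t ht fun s hs => hall s ⟨hs.1, hs.2.le.trans ht.2⟩

/-- The system of differential inequalities that governs the rescaled moments. -/
structure MomentSystem (γ K : ℝ) (Z M M' : ℝ → ℝ) (t₀ t₁ : ℝ) : Prop where
  contZ : ContinuousOn Z (Icc t₀ t₁)
  contM : ContinuousOn M (Icc t₀ t₁)
  derivZ : ∀ t ∈ Ioo t₀ t₁, HasDerivAt Z (M t - 2 * Z t) t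
  derivM : ∀ t ∈ Ioo t₀ t₁, HasDerivAt M (M' t) t
  excess_le : ∀ t ∈ Ioo t₀ t₁, 0 ≤ Z t → K * (1 + t) * excess γ (Z t / (K * (1 + t))) ≤ M' t

lemma MomentSystem.mono {γ K : ℝ} {Z M M' : ℝ → ℝ} {t₀ t₁ a e : ℝ}
    (h : MomentSystem γ K Z M M' t₀ t₁) (ha : t₀ ≤ a) (he : e ≤ t₁) :
    MomentSystem γ K Z M M' a e :=
  ⟨h.contZ.mono (Icc_subset_Icc ha he), h.contM.mono (Icc_subset_Icc ha he),
    fun t ht => h.derivZ t (Ioo_subset_Ioo ha he ht),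
    fun t ht => h.derivM t (Ioo_subset_Ioo ha he ht),
    fun t ht => h.excess_le t (Ioo_subset_Ioo ha he ht)⟩

/-- Subsolutions of the moment system stay below the moments. -/
lemma MomentSystem.subsolution_le {γ K : ℝ} {Z M M' z m m' : ℝ → ℝ} {t₀ t₁ : ℝ}
    (h : MomentSystem γ K Z M M' t₀ t₁)
    (hcz : ContinuousOn z (Icc t₀ t₁)) (hcm : ContinuousOn m (Icc t₀ t₁))
    (hz : ∀ t ∈ Ioo t₀ t₁, HasDerivAt z (m t - 2 * z t) t)
    (hm : ∀ t ∈ Ioo t₀ t₁, HasDerivAt m (m' t) t)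
    (hle : ∀ t ∈ Ioo t₀ t₁, z t ≤ Z t → m' t ≤ M' t) (hz0 : z t₀ < Z t₀) (hm0 : m t₀ ≤ M t₀) :
    ∀ t ∈ Icc t₀ t₁, z t < Z t ∧ m t ≤ M t := by
  intro t ht
  have := comparison (d := fun t => Z t - z t) (D := fun t => M t - m t)
    (D' := fun t => M' t - m' t) (h.contZ.sub hcz) (h.contM.sub hcm)
    (fun t ht => ((h.derivZ t ht).sub (hz t ht)).congr_deriv (by ring))
    (fun t ht => (h.derivM t ht).sub (hm t ht))
    (fun t ht hd => sub_nonneg.2 (hle t ht (sub_nonneg.1 hd))) (sub_pos.2 hz0) (sub_nonneg.2 hm0)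
    t ht
  exact ⟨sub_pos.1 this.1, sub_nonneg.1 this.2⟩

/-- Large moments blow up within unit time. -/
lemma MomentSystem.blowup_of_large {γ : ℝ} (hγ : 1 < γ) :
    ∃ Λ : ℝ, 1 ≤ Λ ∧ ∀ {K : ℝ} {Z M M' : ℝ → ℝ} {t₁ : ℝ}, 0 < K → 0 ≤ t₁ →
      MomentSystem γ K Z M M' t₁ (t₁ + 1) → Λ * (K * (1 + t₁)) ≤ Z t₁ →
      2 * (Λ * (K * (1 + t₁))) ≤ M t₁ → False := by
  obtain ⟨c, hc0, hc⟩ := exists_mul_rpow_le_excess hγ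
  have hγ' : 0 < γ - 1 := by linarith
  -- The exponent for which a pure power (t₁ + 1 - t) ^ (-l) balances z'' against z ^ γ.
  set l : ℝ := 2 / (γ - 1) with hl
  have hl0 : 0 < l := by positivity
  have hlγ : -l * (γ - 1) = -2 := by rw [hl]; field_simp
  obtain ⟨b, hb1, hb⟩ : ∃ b : ℝ, 1 ≤ b ∧ (l * (l + 1) + 2 * l) / c ≤ b ^ (γ - 1) :=
    ((eventually_ge_atTop 1).and ((tendsto_rpow_atTop hγ').eventually_ge_atTop _)).exists
  have hb' : l * (l + 1) + 2 * l ≤ c * b ^ (γ - 1) := by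
    rwa [div_le_iff₀' hc0] at hb
  -- At t₁ the barrier equals 2 b K (1 + t₁) and its companion m equals 2 b (l + 2) K (1 + t₁); the
  -- factor l + 3 covers both, the first one strictly.
  refine ⟨b * (l + 3), by nlinarith, ?_⟩
  intro K Z M M' t₁ hK ht₁ h hZ hM
  -- Doubling makes κ dominate K (1 + t) during the whole unit of time.
  set κ : ℝ := 2 * (K * (1 + t₁)) with hκ
  have hκ0 : 0 < κ := by positivity
  obtain ⟨G, hG⟩ := isCompact_Icc.exists_bound_of_continuousOn h.contZ
  -- The barrier is stopped just before its singularity, at the time when it equals κ b g. That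
  -- value is at least the bound G of Z, a contradiction; the 2 places this time after t₁.
  set g : ℝ := max 2 (G / (κ * b)) with hg
  have hg1 : 1 < g := lt_of_lt_of_le (by norm_num) (le_max_left _ _)
  set σ : ℝ := g ^ (-(1 / l)) with hσ
  have hσ0 : 0 < σ := Real.rpow_pos_of_pos (by linarith) _
  have hσ1 : σ < 1 := Real.rpow_lt_one_of_one_lt_of_neg hg1 (by rw [neg_lt_zero]; positivity)
  have hσl : σ ^ (-l) = g := by
    rw [hσ, ← Real.rpow_mul (by linarith)]
    have : -(1 / l) * -l = 1 := by field_simp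
    rw [this, Real.rpow_one]
  set e : ℝ := t₁ + 1 - σ with he
  have hτ0 : ∀ t ∈ Icc t₁ e, 0 < t₁ + 1 - t := fun t ht => by linarith [ht.2]
  have hpow : ∀ (p : ℝ) {t : ℝ}, 0 < t₁ + 1 - t →
      HasDerivAt (fun t => (t₁ + 1 - t) ^ p) (-(p * (t₁ + 1 - t) ^ (p - 1))) t := fun p t ht =>
    (((hasDerivAt_id t).const_sub (t₁ + 1)).rpow_const (Or.inl ht.ne')).congr_deriv (by simp)
  have hcont : ∀ p : ℝ, ContinuousOn (fun t => (t₁ + 1 - t) ^ p) (Icc t₁ e) := fun p t ht =>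
    (hpow p (hτ0 t ht)).continuousAt.continuousWithinAt
  have hsub := (h.mono le_rfl (by linarith : e ≤ t₁ + 1)).subsolution_le
    (z := fun t => κ * b * (t₁ + 1 - t) ^ (-l))
    (m := fun t => κ * b * (l * (t₁ + 1 - t) ^ (-l - 1) + 2 * (t₁ + 1 - t) ^ (-l)))
    (m' := fun t => κ * b * (l * (-((-l - 1) * (t₁ + 1 - t) ^ (-l - 1 - 1)))
      + 2 * (-(-l * (t₁ + 1 - t) ^ (-l - 1)))))
    (continuousOn_const.mul (hcont _))
    (continuousOn_const.mul ((continuousOn_const.mul (hcont _)).add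
      (continuousOn_const.mul (hcont _)))) ?_ ?_ ?_ ?_ ?_ e ⟨by linarith, le_rfl⟩
  · have h1 := hsub.1
    have h2 := (le_abs_self _).trans (hG e ⟨by linarith, by linarith⟩)
    rw [show t₁ + 1 - e = σ by rw [he]; ring, hσl] at h1
    have h3 : G ≤ κ * b * g := by
      have := le_max_right 2 (G / (κ * b))
      rw [← hg, div_le_iff₀' (by positivity)] at this
      exact this
    linarith
  · intro t ht
    exact ((hpow (-l) (hτ0 t ⟨ht.1.le, ht.2.le⟩)).const_mul (κ * b)).congr_deriv (by ring)
  · intro t ht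
    have h0 := hτ0 t ⟨ht.1.le, ht.2.le⟩
    exact (((hpow (-l - 1) h0).const_mul l).add ((hpow (-l) h0).const_mul 2)).const_mul (κ * b)
  · intro t ht hzZ
    have h0 := hτ0 t ⟨ht.1.le, ht.2.le⟩
    set τ := t₁ + 1 - t with hτ
    have hτ1 : τ ≤ 1 := by linarith [ht.1]
    have h1 : 1 ≤ τ ^ (-l) := Real.one_le_rpow_of_pos_of_le_one_of_nonpos h0 hτ1 (by linarith)
    have hk0 : 0 < K * (1 + t) := mul_pos hK (by linarith [ht.1])
    have hkκ : K * (1 + t) ≤ κ := by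
      rw [hκ]
      nlinarith
    set y := b * τ ^ (-l) with hy
    have hy1 : 1 ≤ y := one_le_mul_of_one_le_of_one_le hb1 h1
    have hyZ : κ * y ≤ Z t := by rw [hy, ← mul_assoc]; exact hzZ
    have hZ0 : 0 ≤ Z t := le_trans (by positivity) hyZ
    set s := Z t / (K * (1 + t)) with hs
    have hys : y ≤ s := by
      rw [hs, le_div_iff₀ hk0]
      nlinarith
    have h2 := mul_le_mul_of_nonneg_left (hc s (hy1.trans hys)) hk0.le
    refine le_trans ?_ (h2.trans (h.excess_le t ⟨ht.1, by linarith [ht.2]⟩ hZ0))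
    have h3 : K * (1 + t) * (c * s ^ γ) = c * (Z t * s ^ (γ - 1)) := by
      have hs0 : s ≠ 0 := by linarith
      have : Z t = s * (K * (1 + t)) := (div_mul_cancel₀ _ hk0.ne').symm
      rw [this, Real.rpow_sub_one hs0]
      field_simp
    have h4 : y ^ (γ - 1) ≤ s ^ (γ - 1) := Real.rpow_le_rpow (by linarith) hys hγ'.le
    have h5 : κ * y * y ^ (γ - 1) ≤ Z t * s ^ (γ - 1) :=
      mul_le_mul hyZ h4 (Real.rpow_nonneg (by linarith) _) hZ0
    have h6 : y ^ (γ - 1) = b ^ (γ - 1) * τ ^ (-2 : ℝ) := by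
      rw [hy, Real.mul_rpow (by linarith) (Real.rpow_nonneg h0.le _), ← Real.rpow_mul h0.le, hlγ]
    have h7 : τ ^ (-l - 1 - 1) = τ ^ (-l) * τ ^ (-2 : ℝ) := by
      rw [← Real.rpow_add h0]
      ring_nf
    have h8 : τ ^ (-l - 1) ≤ τ ^ (-l - 1 - 1) :=
      Real.rpow_le_rpow_of_exponent_ge h0 hτ1 (by linarith)
    rw [h3]
    have h9 : 0 ≤ τ ^ (-l - 1 - 1) := Real.rpow_nonneg h0.le _
    calc κ * b * (l * (-((-l - 1) * τ ^ (-l - 1 - 1))) + 2 * (-(-l * τ ^ (-l - 1))))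
        ≤ κ * b * ((l * (l + 1) + 2 * l) * τ ^ (-l - 1 - 1)) := by
          refine mul_le_mul_of_nonneg_left ?_ (by positivity)
          nlinarith
      _ ≤ κ * b * (c * b ^ (γ - 1) * τ ^ (-l - 1 - 1)) :=
          mul_le_mul_of_nonneg_left (mul_le_mul_of_nonneg_right hb' h9) (by positivity)
      _ = c * (κ * y * y ^ (γ - 1)) := by rw [h6, h7, hy]; ring
      _ ≤ _ := mul_le_mul_of_nonneg_left h5 hc0.le
  · simp only [add_sub_cancel_left, Real.one_rpow, mul_one]
    refine lt_of_lt_of_le ?_ hZ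
    have : 0 < K * (1 + t₁) := by positivity
    rw [hκ]
    nlinarith [mul_pos this (by linarith : 0 < b), mul_pos (mul_pos this (by linarith : 0 < b)) hl0]
  · simp only [add_sub_cancel_left, Real.one_rpow, mul_one]
    refine le_trans ?_ hM
    have : 0 < K * (1 + t₁) := by positivity
    rw [hκ]
    nlinarith [mul_pos this (by linarith : 0 < b), mul_pos (mul_pos this (by linarith : 0 < b)) hl0]

/-- Small positive moments become large within an exponentially long time. -/
lemma MomentSystem.exists_large {γ Λ K : ℝ} (hγ : 1 < γ) (hΛ : 1 ≤ Λ) (hK : 1 ≤ K) :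
    ∃ c : ℝ, 0 < c ∧ ∀ {Z M M' : ℝ → ℝ} {t₀ t₁ z₀ : ℝ}, 0 ≤ t₀ → 0 < z₀ → z₀ ≤ 1 →
      (1 + t₀) * Real.exp (z₀⁻¹ / c) ≤ 1 + t₁ → MomentSystem γ K Z M M' t₀ t₁ →
      z₀ < Z t₀ → 3 * z₀ ≤ M t₀ →
      ∃ τ ∈ Ico t₀ t₁, Λ * (K * (1 + τ)) ≤ Z τ ∧ 2 * (Λ * (K * (1 + τ))) ≤ M τ := by
  set cA : ℝ := (γ - 1) / (4 * (1 + Λ / 2)) with hcA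
  have hcA0 : 0 < cA := div_pos (by linarith) (by linarith)
  -- For z' = c z² / (1 + t), the term 2 Λ K pays for z'' while z ≤ Λ K (1 + t), and the term 2 pays
  -- for 2 z'. Together they stay below the quadratic bound for the excess.
  set c : ℝ := min 1 (cA / (K * (2 * (Λ * K) + 2))) with hc
  have hc0 : 0 < c := lt_min one_pos (by positivity)
  have hc1 : c ≤ 1 := min_le_left _ _
  have hc2 : c * (2 * (Λ * K) + 2) ≤ cA / K := by
    have := min_le_right 1 (cA / (K * (2 * (Λ * K) + 2)))
    rw [← hc, ← div_div, le_div_iff₀ (by positivity)] at this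
    exact this
  refine ⟨c, hc0, ?_⟩
  intro Z M M' t₀ t₁ z₀ ht₀ hz₀ hz₀1 ht₁ h hZ hM
  have hα : 1 ≤ z₀⁻¹ := (one_le_inv₀ hz₀).2 hz₀1
  have ht01 : t₀ ≤ t₁ := by
    have : 1 ≤ Real.exp (z₀⁻¹ / c) := Real.one_le_exp (by positivity)
    linarith [le_mul_of_one_le_right (by linarith : 0 ≤ 1 + t₀) this]
  -- The final value of 1/z: small enough that z has crossed the threshold Λ K (1 + t) by time e <
  -- t₁, yet positive, so that z stays finite.
  set β : ℝ := min z₀⁻¹ (Λ * (K * (1 + t₁)))⁻¹ with hβ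
  have hB0 : 0 < Λ * (K * (1 + t₁)) :=
    mul_pos (by linarith) (mul_pos (by linarith) (by linarith))
  have hβ0 : 0 < β := lt_min (by positivity) (inv_pos.2 hB0)
  set e : ℝ := (1 + t₀) * Real.exp ((z₀⁻¹ - β) / c) - 1 with he
  have hαβ : 0 ≤ z₀⁻¹ - β := sub_nonneg.2 (min_le_left _ _)
  have he0 : t₀ ≤ e := by
    have : 1 ≤ Real.exp ((z₀⁻¹ - β) / c) := Real.one_le_exp (by positivity)
    rw [he]
    linarith [le_mul_of_one_le_right (by linarith : 0 ≤ 1 + t₀) this]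
  have he1 : e < t₁ := by
    have : Real.exp ((z₀⁻¹ - β) / c) < Real.exp (z₀⁻¹ / c) :=
      Real.exp_lt_exp.2 ((div_lt_div_iff_of_pos_right hc0).2 (by linarith))
    rw [he]
    linarith [mul_lt_mul_of_pos_left this (by linarith : 0 < 1 + t₀)]
  set y : ℝ → ℝ := fun t => z₀⁻¹ - c * (Real.log (1 + t) - Real.log (1 + t₀)) with hy
  have hye : y e = β := by
    have : 1 + e = (1 + t₀) * Real.exp ((z₀⁻¹ - β) / c) := by rw [he]; ring
    simp only [hy]
    rw [this, Real.log_mul (by linarith) (Real.exp_pos _).ne', Real.log_exp]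
    field_simp
    ring
  have hy0 : ∀ t ∈ Icc t₀ e, 0 < y t := by
    intro t ht
    have : Real.log (1 + t) ≤ Real.log (1 + e) :=
      Real.log_le_log (by linarith [ht.1]) (by linarith [ht.2])
    have h2 : y e ≤ y t := by
      simp only [hy]
      linarith [mul_le_mul_of_nonneg_left this hc0.le]
    linarith
  have hyd : ∀ t, 0 ≤ t → HasDerivAt y (-(c * (1 + t)⁻¹)) t := by
    intro t ht
    have h1 : HasDerivAt (fun t => Real.log (1 + t)) (1 + t)⁻¹ t :=
      (((hasDerivAt_id t).const_add 1).log (by simp; linarith)).congr_deriv (by simp)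
    exact ((h1.sub_const _).const_mul c).const_sub _
  set z : ℝ → ℝ := fun t => (y t)⁻¹ with hzdef
  have hzd : ∀ t ∈ Icc t₀ e, HasDerivAt z (c * (z t ^ 2 * (1 + t)⁻¹)) t := by
    intro t ht
    refine ((hyd t (ht₀.trans ht.1)).inv (hy0 t ht).ne').congr_deriv ?_
    simp only [hzdef]
    field_simp
  have hzpos : ∀ t ∈ Icc t₀ e, 0 < z t := fun t ht => inv_pos.2 (hy0 t ht)
  have hid : ∀ t, 0 ≤ t → HasDerivAt (fun t : ℝ => (1 + t)⁻¹) (-((1 + t)⁻¹) ^ 2) t := by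
    intro t ht
    refine (((hasDerivAt_id t).const_add 1).inv (by simp; linarith)).congr_deriv ?_
    simp [div_eq_mul_inv]
  have hzc : ContinuousOn z (Icc t₀ e) := fun t ht => (hzd t ht).continuousAt.continuousWithinAt
  have hic : ContinuousOn (fun t : ℝ => (1 + t)⁻¹) (Icc t₀ e) := fun t ht =>
    (hid t (ht₀.trans ht.1)).continuousAt.continuousWithinAt
  set V : Set ℝ := Icc t₀ e ∩ (fun t => z t - Λ * (K * (1 + t))) ⁻¹' Ici 0 with hV
  have hVc : IsCompact V := isCompact_Icc.of_isClosed_subset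
    ((hzc.sub (by fun_prop)).preimage_isClosed_of_isClosed isClosed_Icc isClosed_Ici)
    inter_subset_left
  have heV : e ∈ V := by
    refine ⟨⟨he0, le_rfl⟩, mem_preimage.2 (mem_Ici.2 (sub_nonneg.2 ?_))⟩
    have h1 : Λ * (K * (1 + t₁)) ≤ z e := by
      simp only [hzdef]
      rw [hye, le_inv_comm₀ hB0 hβ0]
      exact min_le_right _ _
    refine le_trans ?_ h1
    gcongr
  -- The first crossing of the threshold. Before it the ratio z / (K (1 + t)) is below Λ, where the
  -- quadratic bound is valid.
  obtain ⟨τ, ⟨hτ, hτV⟩, hleast⟩ := hVc.exists_isLeast ⟨e, heV⟩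
  have hsubI : Icc t₀ τ ⊆ Icc t₀ e := Icc_subset_Icc_right hτ.2
  have hlt : ∀ t ∈ Ioo t₀ τ, z t < Λ * (K * (1 + t)) := by
    intro t ht
    by_contra! hge
    exact absurd (hleast ⟨⟨ht.1.le, ht.2.le.trans hτ.2⟩, sub_nonneg.2 hge⟩) (not_le.2 ht.2)
  have hz0 : z t₀ = z₀ := by simp [hzdef, hy]
  have hsub := (h.mono le_rfl (hτ.2.trans he1.le)).subsolution_le
    (z := z) (m := fun t => c * (z t ^ 2 * (1 + t)⁻¹) + 2 * z t)
    (m' := fun t => c * ((2 * z t * (c * (z t ^ 2 * (1 + t)⁻¹))) * (1 + t)⁻¹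
      + z t ^ 2 * -((1 + t)⁻¹) ^ 2) + 2 * (c * (z t ^ 2 * (1 + t)⁻¹)))
    (hzc.mono hsubI) (((continuousOn_const.mul ((hzc.pow 2).mul hic)).add
      (continuousOn_const.mul hzc)).mono hsubI) ?_ ?_ ?_ ?_ ?_ τ ⟨hτ.1, le_rfl⟩
  · refine ⟨τ, ⟨hτ.1, hτ.2.trans_lt he1⟩, ?_, ?_⟩
    · have h1 := hsub.1
      have h2 : 0 ≤ z τ - Λ * (K * (1 + τ)) := hτV
      linarith
    · have h1 := hsub.2
      have h2 : 0 ≤ z τ - Λ * (K * (1 + τ)) := hτV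
      have h3 : 0 ≤ c * (z τ ^ 2 * (1 + τ)⁻¹) := by
        have : 0 < 1 + τ := by linarith [hτ.1]
        positivity
      linarith
  · intro t ht
    exact (hzd t (hsubI ⟨ht.1.le, ht.2.le⟩)).congr_deriv (by ring)
  · intro t ht
    have h1 := hzd t (hsubI ⟨ht.1.le, ht.2.le⟩)
    have h2 := hid t (ht₀.trans ht.1.le)
    exact (((((h1.pow 2).mul h2).const_mul c).add (h1.const_mul 2))).congr_deriv (by
      simp)
  · intro t ht hzZ
    have htI := hsubI ⟨ht.1.le, ht.2.le⟩
    have hzp := hzpos t htI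
    have h1t : 0 < 1 + t := by linarith [ht.1]
    have hk : 0 < K * (1 + t) := by positivity
    refine le_trans ?_ (h.excess_le t ⟨ht.1, ht.2.trans_le (hτ.2.trans he1.le)⟩
      (hzp.le.trans hzZ))
    have e1 : excess γ (z t / (K * (1 + t))) ≤ excess γ (Z t / (K * (1 + t))) :=
      excess_mono hγ (by positivity) (by gcongr)
    have e2 := mul_sq_le_excess hγ (s := z t / (K * (1 + t))) (Λ := Λ) (by positivity)
      (by rw [div_le_iff₀ hk]; exact (hlt t ht).le)
    refine le_trans ?_ (mul_le_mul_of_nonneg_left (e2.trans e1) hk.le)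
    rw [← hcA]
    have e3 : K * (1 + t) * (cA * (z t / (K * (1 + t))) ^ 2) =
        cA / K * (z t ^ 2 * (1 + t)⁻¹) := by field_simp
    rw [e3]
    refine le_trans ?_ (mul_le_mul_of_nonneg_right hc2 (by positivity))
    have e4 : z t * (1 + t)⁻¹ ≤ Λ * K := by
      rw [← div_eq_mul_inv, div_le_iff₀ h1t]
      linarith [hlt t ht]
    set W := z t ^ 2 * (1 + t)⁻¹ with hW
    have hW0 : 0 ≤ W := by positivity
    have e5 : 0 ≤ c * (z t ^ 2 * ((1 + t)⁻¹) ^ 2) := by positivity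
    have e6 : c * c * (2 * (W * (z t * (1 + t)⁻¹))) ≤ c * (2 * (W * (Λ * K))) := by
      have : c * c ≤ c := mul_le_of_le_one_right hc0.le hc1
      have h7 : W * (z t * (1 + t)⁻¹) ≤ W * (Λ * K) := mul_le_mul_of_nonneg_left e4 hW0
      have h8 : 0 ≤ W * (z t * (1 + t)⁻¹) := by positivity
      calc c * c * (2 * (W * (z t * (1 + t)⁻¹))) ≤ c * (2 * (W * (z t * (1 + t)⁻¹))) :=
            mul_le_mul_of_nonneg_right this (by linarith)
        _ ≤ _ := mul_le_mul_of_nonneg_left (by linarith) hc0.le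
    calc _ = c * c * (2 * (W * (z t * (1 + t)⁻¹))) - c * (z t ^ 2 * ((1 + t)⁻¹) ^ 2)
          + 2 * (c * W) := by ring
      _ ≤ _ := by linarith
  · rw [hz0]
    exact hZ
  · simp only [hz0]
    have h1 : (1 + t₀)⁻¹ ≤ 1 := inv_le_one_of_one_le₀ (by linarith)
    have h1' : 0 ≤ (1 + t₀)⁻¹ := by positivity
    have h2 : z₀ ^ 2 * (1 + t₀)⁻¹ ≤ z₀ := by
      rw [pow_two, mul_assoc]
      exact mul_le_of_le_one_right hz₀.le (mul_le_one₀ hz₀1 h1' h1)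
    have h3 : c * (z₀ ^ 2 * (1 + t₀)⁻¹) ≤ 1 * z₀ :=
      mul_le_mul hc1 h2 (by positivity) zero_le_one
    linarith

/-- The lifespan of the moment system with data of size `ε`. -/
theorem MomentSystem.lifespan {γ K δ D : ℝ} (hγ : 1 < γ) (hK : 1 ≤ K) (hδ : 0 < δ) (hδ1 : δ ≤ 1)
    (hD : 0 ≤ D) :
    ∃ C : ℝ, 0 < C ∧ ∀ {ε : ℝ} {Z M M' : ℝ → ℝ}, 0 < ε → ε ≤ 1 →
      MomentSystem γ K Z M M' 0 (Real.exp (C * ε⁻¹)) →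
      (∀ t ∈ Ioo 0 (Real.exp (C * ε⁻¹)), 0 ≤ M' t) → δ * ε ≤ M 0 → -(D * ε) ≤ Z 0 → False := by
  obtain ⟨Λ, hΛ, hblow⟩ := MomentSystem.blowup_of_large hγ
  obtain ⟨c, hc0, hlarge⟩ := MomentSystem.exists_large (K := K) hγ hΛ hK
  -- By this time the relaxation of Z towards M / 2 has overcome a negative initial value of size D
  -- ε. It does not depend on ε since both quantities scale with ε.
  set t₀ : ℝ := 2 * D / δ + 1 with ht₀
  have ht₀0 : 0 < t₀ := by positivity
  -- The first term absorbs the factor 1 + t₀, the second is ε z₀⁻¹ / c for z₀ = δ ε / 8.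
  refine ⟨t₀ + 8 / (δ * c), by positivity, ?_⟩
  intro ε Z M M' hε hε1 h hM' hM0 hZ0
  set T₁ := Real.exp ((t₀ + 8 / (δ * c)) * ε⁻¹) with hT₁
  set z₀ : ℝ := δ * ε / 8 with hz₀
  have hz₀0 : 0 < z₀ := by positivity
  have hz₀1 : z₀ ≤ 1 := by
    have : δ * ε ≤ 1 := mul_le_one₀ hδ1 hε.le hε1
    rw [hz₀]
    linarith
  have hT : (1 + t₀) * Real.exp (z₀⁻¹ / c) ≤ T₁ := by
    have h1 : 1 + t₀ ≤ Real.exp (t₀ * ε⁻¹) := by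
      refine le_trans ?_ (Real.add_one_le_exp _)
      have := le_mul_of_one_le_right ht₀0.le ((one_le_inv₀ hε).2 hε1)
      linarith
    refine (mul_le_mul_of_nonneg_right h1 (Real.exp_pos _).le).trans (le_of_eq ?_)
    rw [← Real.exp_add, hT₁]
    congr 1
    rw [hz₀]
    field_simp
  have he1 : 1 ≤ Real.exp (z₀⁻¹ / c) := Real.one_le_exp (by positivity)
  have hT0 : 1 + t₀ ≤ T₁ := (le_mul_of_one_le_right (by linarith) he1).trans hT
  have hmono : MonotoneOn M (Icc 0 T₁) := by
    refine monotoneOn_of_deriv_nonneg (convex_Icc _ _) h.contM ?_ ?_ <;> rw [interior_Icc]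
    · exact fun t ht => (h.derivM t ht).differentiableAt.differentiableWithinAt
    · intro t ht
      rw [(h.derivM t ht).deriv]
      exact hM' t ht
  have hMge : ∀ t ∈ Icc 0 T₁, δ * ε ≤ M t := fun t ht =>
    hM0.trans (hmono (left_mem_Icc.2 (ht.1.trans ht.2)) ht ht.1)
  have hsub : Icc 0 t₀ ⊆ Icc 0 T₁ := Icc_subset_Icc_right (by linarith)
  have hder : ∀ t ∈ Ioo 0 t₀, HasDerivAt (fun t => Real.exp (2 * t) * (Z t - δ * ε / 2))
      (Real.exp (2 * t) * (M t - δ * ε)) t := fun t ht =>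
    ((((hasDerivAt_id t).const_mul 2).exp).mul ((h.derivZ t ⟨ht.1, by linarith [ht.2]⟩).sub_const
      (δ * ε / 2))).congr_deriv (by simp; ring)
  have hmono2 : MonotoneOn (fun t => Real.exp (2 * t) * (Z t - δ * ε / 2)) (Icc 0 t₀) := by
    refine monotoneOn_of_deriv_nonneg (convex_Icc _ _)
      ((Continuous.continuousOn (by fun_prop)).mul ((h.contZ.mono hsub).sub continuousOn_const))
      ?_ ?_ <;> rw [interior_Icc]
    · exact fun t ht => (hder t ht).differentiableAt.differentiableWithinAt
    · intro t ht
      rw [(hder t ht).deriv]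
      exact mul_nonneg (Real.exp_pos _).le
        (sub_nonneg.2 (hMge t (hsub ⟨ht.1.le, ht.2.le⟩)))
  have hZt : z₀ < Z t₀ := by
    have h1 := hmono2 (left_mem_Icc.2 ht₀0.le) (right_mem_Icc.2 ht₀0.le) ht₀0.le
    simp only [mul_zero, Real.exp_zero, one_mul] at h1
    have h2 := Real.add_one_le_exp (2 * t₀)
    by_contra! hle
    have h3 : Real.exp (2 * t₀) * (Z t₀ - δ * ε / 2) ≤ (2 * t₀ + 1) * (-(3 / 8 * (δ * ε))) := by
      refine le_trans (mul_le_mul_of_nonneg_left (by rw [hz₀] at hle; linarith :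
        Z t₀ - δ * ε / 2 ≤ -(3 / 8 * (δ * ε))) (Real.exp_pos _).le) ?_
      exact mul_le_mul_of_nonpos_right h2 (by have := mul_pos hδ hε; linarith)
    have h4 : (2 * t₀ + 1) * (-(3 / 8 * (δ * ε))) = -(3 / 2 * (D * ε)) - 9 / 8 * (δ * ε) := by
      rw [ht₀]
      field_simp
      ring
    have := mul_pos hδ hε
    have := mul_nonneg hD hε.le
    linarith
  -- Ending one unit early leaves room for the final blow-up stage inside the time interval.
  obtain ⟨τ, hτ, hτZ, hτM⟩ := hlarge (t₁ := (1 + t₀) * Real.exp (z₀⁻¹ / c) - 1) ht₀0.le hz₀0 hz₀1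
    (by linarith) (h.mono ht₀0.le (by linarith)) hZt (by
      have := hMge t₀ (hsub (right_mem_Icc.2 ht₀0.le))
      have := mul_pos hδ hε
      rw [hz₀]
      linarith)
  exact hblow (by linarith) (ht₀0.le.trans hτ.1)
    (h.mono (ht₀0.le.trans hτ.1) (by linarith [hτ.2])) hτZ hτM

/-! ### From moments to the rescaled system -/

section Reduction

variable {γ μ : ℝ} {T : EReal} {r p s : ℝ × E3 → ℝ} {w b : Fin 3 → ℝ × E3 → ℝ}

/-- The growth constant of the mass of `F` on balls. -/
def growthConst : ℝ := max 1 (8 * surf.real univ * Real.exp 1)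

/-- The rescaled moments of a confined solution obey the moment system. -/
lemma exists_momentSystem (h : ScalarSolution γ μ T r w p s b) (hc : Confined T γ⁻¹ r w p b)
    (hγ : 1 < γ) (hμ : 0 < μ) (hperp : ∀ q ∈ slab T, ∑ i, b i q * q.2 i = 0)
    (hpr : ∀ q ∈ slab T, γ⁻¹ * r q ^ γ ≤ p q) {T₁ : ℝ} (hT₁ : (T₁ : EReal) < T) :
    ∃ M' : ℝ → ℝ, MomentSystem γ growthConst (fun t => Real.exp (-t) * massMoment r t)
      (fun t => Real.exp (-t) * (massMoment r t + momentumMoment r w t)) M' 0 T₁ ∧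
      ∀ t ∈ Ioo 0 T₁, 0 ≤ M' t := by
  have hpb : γ * γ⁻¹ = 1 := mul_inv_cancel₀ (by linarith)
  have hlt : ∀ t ∈ Icc 0 T₁, (t : EReal) < T := fun t ht =>
    (mem_slab_of_le (q := (t, (0 : E3))) hT₁ ht.1 ht.2).2
  have hex : ∀ t, ∃ Y' : ℝ, t ∈ Ioo 0 T₁ → HasDerivAt (momentumMoment r w) Y' t ∧
      ∫ x, (p (t, x) - γ⁻¹) * F x ≤ Y' := fun t => by
    by_cases ht : t ∈ Ioo 0 T₁
    · obtain ⟨Y', hY'⟩ := hasDerivAt_momentumMoment h hc hμ hperp ht.1 (hlt t ⟨ht.1.le, ht.2.le⟩)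
      exact ⟨Y', fun _ => hY'⟩
    · exact ⟨0, fun h => absurd h ht⟩
  choose Y' hY' using hex
  have hexp : ∀ t : ℝ, HasDerivAt (fun t => Real.exp (-t)) (-Real.exp (-t)) t := fun t =>
    ((hasDerivAt_id t).neg.exp).congr_deriv (by simp)
  have hX := fun t (ht : t ∈ Ioo 0 T₁) =>
    hasDerivAt_massMoment h hc ht.1 (hlt t ⟨ht.1.le, ht.2.le⟩)
  have hV : ∀ t : ℝ, 0 ≤ t → ∫ x in Metric.closedBall (0 : E3) (1 + t), F x ≤
      growthConst * (1 + t) * Real.exp t := fun t ht => by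
    refine (setIntegral_ball_F_le (by linarith)).trans ?_
    rw [Real.exp_add]
    calc 8 * surf.real univ * ((1 + t) * (Real.exp 1 * Real.exp t))
        = (8 * surf.real univ * Real.exp 1) * (1 + t) * Real.exp t := by ring
      _ ≤ _ := by
        gcongr
        exact le_max_right _ _
  have hmass : ContinuousOn (massMoment r) (Icc 0 T₁) :=
    (continuousOn_massMoment h hc).mono fun t ht => ⟨ht.1, hlt t ht⟩
  have hmom : ContinuousOn (momentumMoment r w) (Icc 0 T₁) :=
    (continuousOn_momentumMoment h hc).mono fun t ht => ⟨ht.1, hlt t ht⟩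
  have hec : ContinuousOn (fun t : ℝ => Real.exp (-t)) (Icc 0 T₁) :=
    Continuous.continuousOn (by fun_prop)
  refine ⟨fun t => Real.exp (-t) * (Y' t - massMoment r t),
    ⟨hec.mul hmass, hec.mul (hmass.add hmom), fun t ht => ?_, fun t ht => ?_,
      fun t ht hZ => ?_⟩, fun t ht => ?_⟩
  · exact ((hexp t).mul (hX t ht)).congr_deriv (by ring)
  · exact ((hexp t).mul ((hX t ht).add (hY' t ht).1)).congr_deriv (by simp only [Pi.add_apply]; ring)
  · have hk : 0 < growthConst * (1 + t) :=
      mul_pos (lt_of_lt_of_le one_pos (le_max_left _ _)) (by linarith [ht.1])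
    set k := growthConst * (1 + t) with hkdef
    set σ := Real.exp (-t) * massMoment r t / k with hσ
    have hσ0 : 0 ≤ σ := div_nonneg hZ hk.le
    have hee : Real.exp (-t) * Real.exp t = 1 := by rw [← Real.exp_add]; simp
    have hσX : σ * (k * Real.exp t) = massMoment r t := by
      rw [hσ]
      calc _ = (Real.exp (-t) * Real.exp t) * massMoment r t * (k / k) := by ring
        _ = _ := by rw [hee, div_self hk.ne']; ring
    -- The tangent point 1 + σ is the bound-weighted mean of the density; at this choice the tangent
    -- term cancels and Jensen's value remains.
    have h1 := (le_integral_pressure h hc hγ hpb hpr ht.1.le (hlt t ⟨ht.1.le, ht.2.le⟩)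
      (a := 1 + σ) (by linarith) (hV t ht.1.le)).trans (hY' t ht).2
    rw [← hkdef] at h1
    have h2 : γ⁻¹ * ((1 + σ) ^ γ - 1 - γ * (1 + σ) ^ (γ - 1) * (1 + σ - 1)) * (k * Real.exp t)
        + (1 + σ) ^ (γ - 1) * massMoment r t = γ⁻¹ * ((1 + σ) ^ γ - 1) * (k * Real.exp t) := by
      rw [← hσX]
      linear_combination -(1 + σ) ^ (γ - 1) * σ * (k * Real.exp t) * hpb
    rw [h2] at h1
    have h3 : k * excess γ σ = Real.exp (-t) *
        (γ⁻¹ * ((1 + σ) ^ γ - 1) * (k * Real.exp t) - massMoment r t) := by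
      rw [← hσX, excess]
      linear_combination -k * (γ⁻¹ * ((1 + σ) ^ γ - 1) - σ) * hee
    rw [h3]
    exact mul_le_mul_of_nonneg_left (by linarith) (Real.exp_pos _).le
  -- Tangency at 1 removes the volume term and gives Y' ≥ X for either sign of X, hence the
  -- monotonicity of M.
  · have h1 := (le_integral_pressure h hc hγ hpb hpr ht.1.le (hlt t ⟨ht.1.le, ht.2.le⟩)
      (a := 1) one_pos (hV t ht.1.le)).trans (hY' t ht).2
    simp only [Real.one_rpow, sub_self, mul_zero, zero_mul, zero_add, one_mul] at h1
    exact mul_nonneg (Real.exp_pos _).le (by linarith)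

end Reduction

/-- A function with topological support in the unit ball vanishes outside. -/
lemma eq_zero_of_one_lt_norm {E : Type*} [Zero E] {f : E3 → E}
    (hf : tsupport f ⊆ Metric.closedBall 0 1) {x : E3} (hx : 1 < ‖x‖) : f x = 0 := by
  refine image_eq_zero_of_notMem_tsupport fun h => ?_
  have := hf h
  rw [mem_closedBall_zero_iff] at this
  linarith

end MHD

end

/-! ### The lifespan bound -/

open MHD in
theorem theorem1 (γ μ A Sbar : ℝ) (hγ : 1 < γ) (hμ : 0 < μ)
    (hA : A = (γ * Real.exp Sbar)⁻¹)
    (ρ₀ : E3 → ℝ) (u₀ : E3 → E3) (S₀ : E3 → ℝ) (B₀ : E3 → E3)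
    (hρ₀ : ContDiff ℝ 1 ρ₀) (hu₀ : ContDiff ℝ 1 u₀)
    (hS₀ : ContDiff ℝ 1 S₀) (hB₀ : ContDiff ℝ 1 B₀)
    (hρ₀supp : tsupport ρ₀ ⊆ Metric.closedBall 0 1)
    (hu₀supp : tsupport u₀ ⊆ Metric.closedBall 0 1)
    (hS₀supp : tsupport S₀ ⊆ Metric.closedBall 0 1)
    (hB₀supp : tsupport B₀ ⊆ Metric.closedBall 0 1)
    (hS₀nonneg : ∀ x, 0 ≤ S₀ x)
    (hpos : 0 < (∫ x, ρ₀ x * F x) + ∫ x, inner ℝ (∇ F x) (u₀ x)) :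
    ∃ C ε₀ : ℝ, 0 < C ∧ 0 < ε₀ ∧
      ∀ ε : ℝ, 0 < ε → ε ≤ ε₀ →
        ∀ (T : EReal) (ρ : ℝ → E3 → ℝ) (u : ℝ → E3 → E3) (S : ℝ → E3 → ℝ) (B : ℝ → E3 → E3),
          IsC1Solution A γ μ T ρ u S B →
          IsAxisymmetric T ρ u S B →
          (∀ x, ρ 0 x = 1 + ε * ρ₀ x) →
          (∀ x, u 0 x = ε • u₀ x) →
          (∀ x, S 0 x = Sbar + ε * S₀ x) →
          (∀ x, B 0 x = ε • B₀ x) →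
          T ≤ ((Real.exp (C * ε⁻¹) : ℝ) : EReal) := by
  set J₁ := ∫ x, ρ₀ x * F x with hJ₁
  set J₂ := ∫ x, inner ℝ (∇ F x) (u₀ x) with hJ₂
  -- The quadratic correction in the initial momentum, since ρ u = (1 + ε ρ₀) ε u₀. The threshold
  -- for ε lets it consume at most half of the positive first-order term.
  set J₃ := ∫ x, ρ₀ x * inner ℝ (∇ F x) (u₀ x) with hJ₃
  set δ := min 1 ((J₁ + J₂) / 2) with hδ
  have hδ0 : 0 < δ := lt_min one_pos (by linarith)
  obtain ⟨C, hC, hlife⟩ := MomentSystem.lifespan (γ := γ) (K := growthConst) (δ := δ) (D := |J₁|)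
    hγ (le_max_left _ _) hδ0 (min_le_left _ _) (abs_nonneg _)
  refine ⟨C, min 1 ((J₁ + J₂) / (2 * (|J₃| + 1))), hC, lt_min one_pos (by positivity), ?_⟩
  intro ε hε hεle T ρ u S B hsol hax hρ hu hS hB
  have hε1 : ε ≤ 1 := hεle.trans (min_le_left _ _)
  have hεJ : ε * |J₃| ≤ (J₁ + J₂) / 2 := by
    have h1 := hεle.trans (min_le_right _ _)
    rw [le_div_iff₀ (by positivity)] at h1
    nlinarith [abs_nonneg J₃]
  by_contra! hT
  have hγ0 : γ ≠ 0 := by linarith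
  -- The normalisation of the sound speed: the background pressure is 1/γ.
  have hA' : A * Real.exp Sbar = γ⁻¹ := by
    rw [hA, mul_inv, mul_assoc, inv_mul_cancel₀ (Real.exp_pos _).ne', mul_one]
  have hA0 : 0 < A := by
    rw [hA]
    have := Real.exp_pos Sbar
    positivity
  have h := hsol.scalarSolution
  have hpb : γ * γ⁻¹ = 1 := mul_inv_cancel₀ hγ0
  have hc : Confined T γ⁻¹ (fun q => ρ q.1 q.2) (fun i q => u q.1 q.2 i)
      (fun q => pressure A γ (ρ q.1 q.2) (S q.1 q.2)) (fun i q => B q.1 q.2 i) := by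
    intro q hq hx
    refine eq_of_energy_eq_zero (eq_const_of_one_add_lt_norm h hpb (fun x hx => ?_) hq hx)
    simp [energy, pressure, hρ, hu, hS, hB, eq_zero_of_one_lt_norm hρ₀supp hx,
      eq_zero_of_one_lt_norm hu₀supp hx, eq_zero_of_one_lt_norm hS₀supp hx,
      eq_zero_of_one_lt_norm hB₀supp hx, hA']
  -- The energy does not contain the entropy; outside the ball it is recovered from the density and
  -- the pressure.
  have hSout : ∀ q ∈ slab T, 1 + q.1 < ‖q.2‖ → S q.1 q.2 = Sbar := by
    intro q hq hx
    obtain ⟨e1, -, -, e4⟩ := hc q hq hx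
    simp only at e1 e4
    rw [e4, pressure, Real.one_rpow, mul_one, ← hA'] at e1
    exact Real.exp_injective (mul_left_cancel₀ hA0.ne' e1)
  have hSle : ∀ q ∈ slab T, Sbar ≤ S q.1 q.2 := fun q hq =>
    le_entropy h hSout (fun x => by
      simp only [hS]
      linarith [mul_nonneg hε.le (hS₀nonneg x)]) hq
  have hpr : ∀ q ∈ slab T, γ⁻¹ * ρ q.1 q.2 ^ γ ≤ pressure A γ (ρ q.1 q.2) (S q.1 q.2) := by
    intro q hq
    have h1 : 0 ≤ ρ q.1 q.2 ^ γ := Real.rpow_nonneg (h.pos q hq).le _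
    have h2 := Real.exp_le_exp.2 (hSle q hq)
    rw [← hA', pressure]
    calc A * Real.exp Sbar * ρ q.1 q.2 ^ γ = A * ρ q.1 q.2 ^ γ * Real.exp Sbar := by ring
      _ ≤ _ := mul_le_mul_of_nonneg_left h2 (mul_nonneg hA0.le h1)
  obtain ⟨M', hsys, hM'⟩ := exists_momentSystem h hc hγ hμ
    (fun q hq => inner_eq_zero_of_axisymmetric hsol.contDiff_magnetic hax hq) hpr hT
  have hF := contDiff_F.continuous
  have hF' := fun i => (contDiff_pd_F i).continuous
  have hgrad : ∀ x, inner ℝ (∇ F x) (u₀ x) = ∑ i, u₀ x i * pd i F x := fun x => by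
    rw [inner_eq_sum]
    exact Finset.sum_congr rfl fun i _ => by rw [gradient_apply, mul_comm]
  have hcu : Continuous fun x => inner ℝ (∇ F x) (u₀ x) := by
    simp_rw [hgrad]
    have := hu₀.continuous
    fun_prop
  have hi2 : Integrable fun x => inner ℝ (∇ F x) (u₀ x) :=
    hcu.integrable_of_hasCompactSupport (hasCompactSupport_of_norm (R := 1) fun x hx => by
      simp [eq_zero_of_one_lt_norm hu₀supp hx])
  have hi3 : Integrable fun x => ρ₀ x * inner ℝ (∇ F x) (u₀ x) :=
    (hρ₀.continuous.mul hcu).integrable_of_hasCompactSupport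
      (hasCompactSupport_of_norm (R := 1) fun x hx => by
        simp [eq_zero_of_one_lt_norm hu₀supp hx])
  have hX0 : massMoment (fun q => ρ q.1 q.2) 0 = ε * J₁ := by
    rw [massMoment, hJ₁, ← integral_const_mul]
    refine integral_congr_ae (Filter.Eventually.of_forall fun x => ?_)
    simp only [hρ]
    ring
  have hY0 : momentumMoment (fun q => ρ q.1 q.2) (fun i q => u q.1 q.2 i) 0 =
      ε * J₂ + ε ^ 2 * J₃ := by
    rw [momentumMoment, hJ₂, hJ₃, ← integral_const_mul, ← integral_const_mul,
      ← integral_add (hi2.const_mul _) (hi3.const_mul _)]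
    refine integral_congr_ae (Filter.Eventually.of_forall fun x => ?_)
    simp only [hρ, hu, hgrad, PiLp.smul_apply, smul_eq_mul, Fin.sum_univ_three]
    ring
  refine hlife hε hε1 hsys hM' ?_ ?_
  · simp only [neg_zero, Real.exp_zero, one_mul, hX0, hY0]
    have h1 : δ * ε ≤ (J₁ + J₂) / 2 * ε := mul_le_mul_of_nonneg_right (min_le_right _ _) hε.le
    have h2 := mul_le_mul_of_nonneg_left hεJ hε.le
    have h3 := mul_le_mul_of_nonneg_left (neg_abs_le J₃) (sq_nonneg ε)
    linarith
  · simp only [neg_zero, Real.exp_zero, one_mul, hX0]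
    have := mul_le_mul_of_nonneg_left (neg_abs_le J₁) hε.le
    linarith
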